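/- Let $n\in\{1,2,3\}$, let $\Omega\subset\mathbb R^n$ be a bounded domain with smooth boundary, let $0<T<\infty$, and let all functions take values in $\mathbb K\in\{\mathbb R,\mathbb C\}$. Let $H^{1/2}(\partial\Omega)$ be the space of traces $w|_{\partial\Omega}$, $w\in H^1(\Omega)$, let $(H^1(\Omega))'$ and $H^{-1/2}(\partial\Omega)$ be the duals of $H^1(\Omega)$ and $H^{1/2}(\partial\Omega)$, and let $\langle\cdot,\cdot\rangle$ denote the corresponding bilinear duality pairings (no complex conjugation). Identify $z\in L^2(\Omega)$ with the functional $w\mapsto\int_\Omega z\,w\,dx$ on $H^1(\Omega)$, and let $$W(0,T;H^1(\Omega),(H^1(\Omega))')=\{u\in L^2(0,T;H^1(\Omega)) : u'\in L^2(0,T;(H^1(\Omega))')\},$$ where $u'$ is the derivative in the sense of $(H^1(\Omega))'$-valued distributions on $(0,T)$. Let $\rho\in L^\infty(\partial\Omega)$, $f_0,f_1\in L^2(0,T;(H^1(\Omega))')$, $h_0,h_1\in L^2(0,T;H^{-1/2}(\partial\Omega))$, and let $u,v\in W(0,T;H^1(\Omega),(H^1(\Omega))')$. Suppose that $u$ is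 a weak solution of $$\partial_tu-\Delta u=f_0\ \text{ in }\Omega\times(0,T),\qquad \nabla u\cdot\nu+\rho u=h_0\ \text{ on }\partial\Omega\times(0,T),$$ that is, for all $w\in H^1(\Omega)$, $$\langle u'(t),w\rangle+\int_\Omega\nabla u(t)\cdot\nabla w\,dx+\int_{\partial\Omega}u(t)|_{\partial\Omega}\,w|_{\partial\Omega}\,\rho\,dS=\langle f_0(t),w\rangle+\langle h_0(t),w|_{\partial\Omega}\rangle$$ in the sense of distributions on $(0,T)$, and that $v$ is a weak solution of $$\partial_tv+\Delta v=f_1\ \text{ in }\Omega\times(0,T),\qquad \nabla v\cdot\nu+\rho v=h_1\ \text{ on }\partial\Omega\times(0,T),$$ that is, for all $w\in H^1(\Omega)$, $$\langle v'(t),w\rangle-\int_\Omega\nabla v(t)\cdot\nabla w\,dx-\int_{\partial\Omega}v(t)|_{\partial\Omega}\,w|_{\partial\Omega}\,\rho\,dS=\langle f_1(t),w\rangle-\langle h_1(t),w|_{\partial\Omega}\rangle$$ in the sense of distributions on $(0,T)$. Then $u$ and $v$ are equal almost everywhere in $(0,T)$ to continuous functions $[0,T]\to L^2(\Omega)$,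 and, with $u(\cdot,0),u(\cdot,T),v(\cdot,0),v(\cdot,T)\in L^2(\Omega)$ denoting the values of these continuous functions at $0$ and $T$, $$\int_0^T\Big(\langle h_1(t),u(t)|_{\partial\Omega}\rangle-\langle h_0(t),v(t)|_{\partial\Omega}\rangle\Big)dt=\int_\Omega u(x,0)v(x,0)\,dx-\int_\Omega u(x,T)v(x,T)\,dx+\int_0^T\Big(\langle f_1(t),u(t)\rangle+\langle f_0(t),v(t)\rangle\Big)dt.$$ -/

import Mathlib

open MeasureTheory Set
open scoped ContDiff ENNReal

namespace RobinHeat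

noncomputable section

/-- Test functions on an open set `U`: smooth real functions on the whole space whose support is
a compact subset of `U`. -/
def IsTestFunction {E : Type*} [NormedAddCommGroup E] [NormedSpace ℝ E]
    (U : Set E) (φ : E → ℝ) : Prop :=
  ContDiff ℝ ∞ φ ∧ HasCompactSupport φ ∧ tsupport φ ⊆ U

/-- A bounded domain (non-empty connected open set) with smooth boundary: near each boundary point
the domain is the set where a smooth function without critical points is negative, so it lies
locally on one side of a smooth hypersurface. -/
structure IsBoundedSmoothDomain {n : ℕ} (Ω : Set (EuclideanSpace ℝ (Fin n))) : Prop where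
  isOpen : IsOpen Ω
  isConnected : IsConnected Ω
  isBounded : Bornology.IsBounded Ω
  smooth_frontier : ∀ x ∈ frontier Ω, ∃ (U : Set (EuclideanSpace ℝ (Fin n)))
    (ψ : EuclideanSpace ℝ (Fin n) → ℝ), IsOpen U ∧ x ∈ U ∧ ContDiffOn ℝ ∞ ψ U ∧
      ψ x = 0 ∧ (∀ y ∈ U, fderiv ℝ ψ y ≠ 0) ∧ Ω ∩ U = {y | ψ y < 0} ∩ U

/-- The surface measure `dS` on `∂Ω`: the `(n-1)`-dimensional Hausdorff measure with the Euclidean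
normalisation (counting measure if `n = 1`). -/
def surfaceMeasure {n : ℕ} (Ω : Set (EuclideanSpace ℝ (Fin n))) :
    Measure (EuclideanSpace ℝ (Fin n)) :=
  (Measure.euclideanHausdorffMeasure (n - 1)).restrict (frontier Ω)

section Spaces

variable (𝕜 : Type*) [RCLike 𝕜] {n : ℕ} (Ω : Set (EuclideanSpace ℝ (Fin n)))

/-- `L²(Ω)`. -/
abbrev L2 : Type _ := Lp 𝕜 2 (volume.restrict Ω)

/-- `L²(Ω)ⁿ`. -/
abbrev L2Vec : Type _ := Lp (EuclideanSpace 𝕜 (Fin n)) 2 (volume.restrict Ω)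

/-- `L²(∂Ω)`. -/
abbrev L2Boundary : Type _ := Lp 𝕜 2 (surfaceMeasure Ω)

/-- `L^∞(∂Ω)`. -/
abbrev LInftyBoundary : Type _ := Lp 𝕜 ∞ (surfaceMeasure Ω)

variable {𝕜 Ω} in
/-- `g` is the gradient of `u` in the sense of distributions on `Ω`. -/
def IsWeakGradient (u : L2 𝕜 Ω) (g : L2Vec 𝕜 Ω) : Prop :=
  ∀ φ : EuclideanSpace ℝ (Fin n) → ℝ, IsTestFunction Ω φ → ∀ i : Fin n,
    ∫ x in Ω, fderiv ℝ φ x (EuclideanSpace.single i 1) • u x = - ∫ x in Ω, φ x • g x i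

theorem integrable_smul_of_memLp {F : Type*} [NormedAddCommGroup F] [NormedSpace ℝ F]
    {φ : EuclideanSpace ℝ (Fin n) → ℝ} (hφ : Continuous φ) (hc : HasCompactSupport φ)
    {f : EuclideanSpace ℝ (Fin n) → F} (hf : MemLp f 2 (volume.restrict Ω)) :
    Integrable (fun x => φ x • f x) (volume.restrict Ω) := by
  have h1 : MemLp φ 2 (volume.restrict Ω) := (hφ.memLp_of_hasCompactSupport hc).restrict Ω
  exact memLp_one_iff_integrable.1 (hf.smul h1)

variable {𝕜 Ω} in
theorem integrable_weakGradient (u : L2 𝕜 Ω) (g : L2Vec 𝕜 Ω)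
    {φ : EuclideanSpace ℝ (Fin n) → ℝ} (hφ : IsTestFunction Ω φ) (i : Fin n) :
    Integrable (fun x => fderiv ℝ φ x (EuclideanSpace.single i 1) • u x) (volume.restrict Ω) ∧
      Integrable (fun x => φ x • g x i) (volume.restrict Ω) := by
  obtain ⟨h1, h2, -⟩ := hφ
  constructor
  · refine integrable_smul_of_memLp Ω ?_ (h2.fderiv_apply ℝ _) (Lp.memLp u)
    exact (h1.continuous_fderiv (by simp)).clm_apply continuous_const
  · refine integrable_smul_of_memLp Ω h1.continuous h2 ?_
    exact (EuclideanSpace.proj (𝕜 := 𝕜) i).comp_memLp' (Lp.memLp g)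

/-- The Sobolev space `H¹(Ω)`: the pairs `(u, ∇u)` with `u ∈ L²(Ω)` and weak gradient
`∇u ∈ L²(Ω)ⁿ`, with the norm `(‖u‖² + ‖∇u‖²)^(1/2)`. -/
def H1 : Submodule 𝕜 (WithLp 2 (L2 𝕜 Ω × L2Vec 𝕜 Ω)) where
  carrier := {p | IsWeakGradient p.fst p.snd}
  zero_mem' := by
    intro φ _ i
    have h1 : ((0 : L2 𝕜 Ω) : EuclideanSpace ℝ (Fin n) → 𝕜) =ᵐ[volume.restrict Ω] 0 :=
      Lp.coeFn_zero _ _ _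
    have h2 : ((0 : L2Vec 𝕜 Ω) : EuclideanSpace ℝ (Fin n) → EuclideanSpace 𝕜 (Fin n))
        =ᵐ[volume.restrict Ω] 0 := Lp.coeFn_zero _ _ _
    have e1 : ∫ x in Ω, fderiv ℝ φ x (EuclideanSpace.single i 1) • (0 : L2 𝕜 Ω) x = 0 := by
      apply integral_eq_zero_of_ae
      filter_upwards [h1] with x hx
      simp only [hx, Pi.zero_apply, smul_zero]
    have e2 : ∫ x in Ω, φ x • (0 : L2Vec 𝕜 Ω) x i = 0 := by
      apply integral_eq_zero_of_ae
      filter_upwards [h2] with x hx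
      simp only [hx, Pi.zero_apply, PiLp.zero_apply, smul_zero]
    exact e1.trans (neg_eq_zero.2 e2).symm
  add_mem' := by
    intro p q hp hq φ hφ i
    obtain ⟨a1, b1⟩ := integrable_weakGradient (p.fst) (p.snd) hφ i
    obtain ⟨a2, b2⟩ := integrable_weakGradient (q.fst) (q.snd) hφ i
    have e1 : ∫ x in Ω, fderiv ℝ φ x (EuclideanSpace.single i 1) • (p.fst + q.fst : L2 𝕜 Ω) x =
        (∫ x in Ω, fderiv ℝ φ x (EuclideanSpace.single i 1) • p.fst x) +
          ∫ x in Ω, fderiv ℝ φ x (EuclideanSpace.single i 1) • q.fst x := by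
      rw [← integral_add a1 a2]
      apply integral_congr_ae
      filter_upwards [Lp.coeFn_add p.fst q.fst] with x hx
      simp only [hx, Pi.add_apply, smul_add]
    have e2 : ∫ x in Ω, φ x • (p.snd + q.snd : L2Vec 𝕜 Ω) x i =
        (∫ x in Ω, φ x • p.snd x i) + ∫ x in Ω, φ x • q.snd x i := by
      rw [← integral_add b1 b2]
      apply integral_congr_ae
      filter_upwards [Lp.coeFn_add p.snd q.snd] with x hx
      simp only [hx, Pi.add_apply, PiLp.add_apply, smul_add]
    refine e1.trans ?_
    rw [hp φ hφ i, hq φ hφ i, ← neg_add, ← e2]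
    rfl
  smul_mem' := by
    intro c p hp φ hφ i
    have e1 : ∫ x in Ω, fderiv ℝ φ x (EuclideanSpace.single i 1) • (c • p.fst : L2 𝕜 Ω) x =
        c * ∫ x in Ω, fderiv ℝ φ x (EuclideanSpace.single i 1) • p.fst x := by
      rw [← integral_const_mul]
      apply integral_congr_ae
      filter_upwards [Lp.coeFn_smul c p.fst] with x hx
      simp [hx]
    have e2 : ∫ x in Ω, φ x • (c • p.snd : L2Vec 𝕜 Ω) x i = c * ∫ x in Ω, φ x • p.snd x i := by
      rw [← integral_const_mul]
      apply integral_congr_ae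
      filter_upwards [Lp.coeFn_smul c p.snd] with x hx
      simp [hx]
    refine e1.trans ?_
    rw [hp φ hφ i, mul_neg, ← e2]
    rfl

variable {𝕜 Ω} in
/-- The gradient `∇u` of `u ∈ H¹(Ω)`. -/
def H1.grad (u : H1 𝕜 Ω) : L2Vec 𝕜 Ω := u.1.snd

/-- The inclusion `H¹(Ω) → L²(Ω)`. -/
def H1.toL2 : H1 𝕜 Ω →L[𝕜] L2 𝕜 Ω :=
  (WithLp.fstL 2 𝕜 (L2 𝕜 Ω) (L2Vec 𝕜 Ω)).comp (H1 𝕜 Ω).subtypeL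

/-- `(H¹(Ω))'`, the space of bounded linear functionals on `H¹(Ω)`. -/
abbrev H1Dual : Type _ := H1 𝕜 Ω →L[𝕜] 𝕜

/-- The embedding `H¹(Ω) → L²(Ω) → (H¹(Ω))'` by means of the bilinear pairing
`⟨u, w⟩ = ∫_Ω u w dx`. -/
def H1.toDual : H1 𝕜 Ω →L[𝕜] H1Dual 𝕜 Ω :=
  ((ContinuousLinearMap.mul 𝕜 𝕜).lpPairing (volume.restrict Ω) 2 2).bilinearComp
    (H1.toL2 𝕜 Ω) (H1.toL2 𝕜 Ω)

theorem H1.toDual_apply (u w : H1 𝕜 Ω) :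
    H1.toDual 𝕜 Ω u w = ∫ x in Ω, H1.toL2 𝕜 Ω u x * H1.toL2 𝕜 Ω w x := by
  simp [H1.toDual, ContinuousLinearMap.lpPairing_eq_integral]

variable {𝕜 Ω} in
/-- A bounded linear operator `H¹(Ω) → L²(∂Ω)` is the trace operator if it restricts every
function that is smooth up to the boundary to its boundary values. On a bounded smooth domain there
is exactly one such operator. -/
def IsTraceOperator (γ : H1 𝕜 Ω →L[𝕜] L2Boundary 𝕜 Ω) : Prop :=
  ∀ φ : EuclideanSpace ℝ (Fin n) → 𝕜, ContDiff ℝ ∞ φ →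
    ∀ u : H1 𝕜 Ω, H1.toL2 𝕜 Ω u =ᵐ[volume.restrict Ω] φ → γ u =ᵐ[surfaceMeasure Ω] φ

open Classical in
/-- The trace operator `u ↦ u|_{∂Ω}` from `H¹(Ω)` to `L²(∂Ω)`. (The second branch is never taken
on a bounded smooth domain, by the trace theorem.) -/
def trace : H1 𝕜 Ω →L[𝕜] L2Boundary 𝕜 Ω :=
  if h : ∃ γ : H1 𝕜 Ω →L[𝕜] L2Boundary 𝕜 Ω, IsTraceOperator γ then h.choose else 0

instance isClosed_ker_trace : IsClosed ((trace 𝕜 Ω).ker : Set (H1 𝕜 Ω)) :=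
  (trace 𝕜 Ω).isClosed_ker

/-- `H^{1/2}(∂Ω)`, the space of traces of functions in `H¹(Ω)`, with the norm
`‖g‖ = inf {‖u‖ | u ∈ H¹(Ω), u|_{∂Ω} = g}`; that is, `H¹(Ω)` modulo the kernel of the trace. -/
abbrev HHalf : Type _ := H1 𝕜 Ω ⧸ (trace 𝕜 Ω).ker

/-- The trace as an operator from `H¹(Ω)` onto `H^{1/2}(∂Ω)`. -/
def traceHalf : H1 𝕜 Ω →L[𝕜] HHalf 𝕜 Ω := (trace 𝕜 Ω).ker.mkQL

/-- The embedding `H^{1/2}(∂Ω) → L²(∂Ω)`. -/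
def HHalf.toL2 : HHalf 𝕜 Ω →ₗ[𝕜] L2Boundary 𝕜 Ω :=
  (trace 𝕜 Ω).ker.liftQ (trace 𝕜 Ω : H1 𝕜 Ω →ₗ[𝕜] L2Boundary 𝕜 Ω) le_rfl

theorem HHalf.toL2_injective : Function.Injective (HHalf.toL2 𝕜 Ω) :=
  LinearMap.ker_eq_bot.1 (Submodule.ker_liftQ_eq_bot _ _ _ le_rfl)

theorem HHalf.toL2_traceHalf (u : H1 𝕜 Ω) :
    HHalf.toL2 𝕜 Ω (traceHalf 𝕜 Ω u) = trace 𝕜 Ω u := rfl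

/-- `H^{-1/2}(∂Ω)`, the dual space of `H^{1/2}(∂Ω)`. -/
abbrev HMinusHalf : Type _ := HHalf 𝕜 Ω →L[𝕜] 𝕜

/-- `L²(0, T; X)` for a normed space `X`. -/
abbrev L2Time (T : ℝ) (X : Type*) [NormedAddCommGroup X] : Type _ :=
  Lp X 2 (volume.restrict (Ioo (0 : ℝ) T))

/-- The space `W(0, T; H¹(Ω), (H¹(Ω))')`: functions `u ∈ L²(0, T; H¹(Ω))` together with their
derivative `u' ∈ L²(0, T; (H¹(Ω))')` in the sense of `(H¹(Ω))'`-valued distributions on `(0, T)`,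
which is determined by `u`. -/
structure W (T : ℝ) where
  val : L2Time T (H1 𝕜 Ω)
  deriv : L2Time T (H1Dual 𝕜 Ω)
  isDeriv : ∀ φ : ℝ → ℝ, IsTestFunction (Ioo 0 T) φ →
    ∫ t in Ioo 0 T, _root_.deriv φ t • H1.toDual 𝕜 Ω (val t) = - ∫ t in Ioo 0 T, φ t • deriv t

end Spaces

variable {𝕜 : Type*} [RCLike 𝕜] {n : ℕ} {Ω : Set (EuclideanSpace ℝ (Fin n))}

/-- `∫_Ω ∇u · ∇w dx`. -/
def dirichletForm (u w : H1 𝕜 Ω) : 𝕜 :=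
  ∫ x in Ω, ∑ i, H1.grad u x i * H1.grad w x i

/-- `∫_{∂Ω} u|_{∂Ω} w|_{∂Ω} ρ dS`. -/
def boundaryForm (ρ : LInftyBoundary 𝕜 Ω) (u w : H1 𝕜 Ω) : 𝕜 :=
  ∫ x, trace 𝕜 Ω u x * trace 𝕜 Ω w x * ρ x ∂(surfaceMeasure Ω)

/-- Weak solutions of `∂ₜu - Δu = f` in `Ω × (0, T)`, `∇u · ν + ρ u = h` on `∂Ω × (0, T)`. -/
def IsForwardWeakSolution {T : ℝ} (ρ : LInftyBoundary 𝕜 Ω) (f : L2Time T (H1Dual 𝕜 Ω))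
    (h : L2Time T (HMinusHalf 𝕜 Ω)) (u : W 𝕜 Ω T) : Prop :=
  ∀ w : H1 𝕜 Ω, ∀ φ : ℝ → ℝ, IsTestFunction (Ioo 0 T) φ →
    ∫ t in Ioo 0 T,
        φ t • (u.deriv t w + dirichletForm (u.val t) w + boundaryForm ρ (u.val t) w) =
      ∫ t in Ioo 0 T, φ t • (f t w + h t (traceHalf 𝕜 Ω w))

/-- Weak solutions of `∂ₜv + Δv = f` in `Ω × (0, T)`, `∇v · ν + ρ v = h` on `∂Ω × (0, T)`. -/
def IsBackwardWeakSolution {T : ℝ} (ρ : LInftyBoundary 𝕜 Ω) (f : L2Time T (H1Dual 𝕜 Ω))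
    (h : L2Time T (HMinusHalf 𝕜 Ω)) (v : W 𝕜 Ω T) : Prop :=
  ∀ w : H1 𝕜 Ω, ∀ φ : ℝ → ℝ, IsTestFunction (Ioo 0 T) φ →
    ∫ t in Ioo 0 T,
        φ t • (v.deriv t w - dirichletForm (v.val t) w - boundaryForm ρ (v.val t) w) =
      ∫ t in Ioo 0 T, φ t • (f t w - h t (traceHalf 𝕜 Ω w))

/-- `U` restricts to a continuous function `[0, T] → L²(Ω)` that is equal to `u` almost everywhere
in `(0, T)`. The values `u(t)`, `t ∈ [0, T]`, of `u` are those of `U`. -/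
def IsContinuousRepresentative {T : ℝ} (u : W 𝕜 Ω T) (U : ℝ → L2 𝕜 Ω) : Prop :=
  ContinuousOn U (Icc 0 T) ∧
    ∀ᵐ t ∂(volume.restrict (Ioo (0 : ℝ) T)), U t = H1.toL2 𝕜 Ω (u.val t)

end

end RobinHeat

/-! Formally, the identity is the integral over `(0, T)` of `d/dt ∫ u v = ⟨u', v⟩ + ⟨v', u⟩`. Test
the equation for `u` with `v(t)` and the equation for `v` with `u(t)`, and add: the Dirichlet and
boundary forms are symmetric and enter with opposite signs, so they cancel and only the data remain.

Two things need proof. The test element now depends on `t`, so the weak equations must hold as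
equalities of functionals for almost every `t`, outside one null set; this is
`ae_eq_of_forall_integral_smul_eq`. And calculus in `W` must be justified for functions that are
only square integrable with values in `H¹`, with derivative in the dual.

For the latter, `ae_eq_add_primitive_of_weakDeriv` makes `D u` a primitive of `u'`, where `D` embeds
`H¹` into its dual. `product_rule` then differentiates the symmetric pairing `D u (v)` by difference
quotients: increments of `D u` are Steklov averages of `u'`, and these converge against translates
because translation is continuous in `L²`.

The pairing is bilinear, so `‖u‖²` in `L²` is the pairing of `u` with its conjugate `C u`. Applying
the product rule to `u` and `C u` gives the energy identity `exists_norm_sq_eq_primitive`. From it,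
`exists_continuousOn_ae_eq` bounds the oscillation of `u` in `L²` by that of a continuous real
function, which yields the continuous representative and gives meaning to the values at `0` and `T`.
-/

namespace RobinHeat

open Filter Topology ComplexConjugate

/-! ### Weak derivatives of vector-valued functions on an interval -/

section WeakDerivative

variable {F : Type*} [NormedAddCommGroup F] [NormedSpace ℝ F]

theorem exists_Icc_subset_of_isCompact {T : ℝ} (hT : 0 < T) {K : Set ℝ} (hK : IsCompact K)
    (hKT : K ⊆ Ioo 0 T) : ∃ a b, 0 < a ∧ b < T ∧ K ⊆ Icc a b := by
  rcases K.eq_empty_or_nonempty with rfl | hne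
  -- For empty `K` any interval inside `(0, T)` serves.
  · exact ⟨T / 2, T / 2, by positivity, by linarith, empty_subset _⟩
  · exact ⟨sInf K, sSup K, (hKT (hK.sInf_mem hne)).1, (hKT (hK.sSup_mem hne)).2,
      fun x hx => ⟨csInf_le hK.bddBelow hx, le_csSup hK.bddAbove hx⟩⟩

/-- The primitive of a test function with vanishing integral is a test function. -/
theorem isTestFunction_primitive {T : ℝ} (hT : 0 < T) {η : ℝ → ℝ}
    (hη : IsTestFunction (Ioo 0 T) η) (h0 : ∫ t in (0 : ℝ)..T, η t = 0) :
    IsTestFunction (Ioo 0 T) (fun t => ∫ s in (0 : ℝ)..t, η s) ∧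
      deriv (fun t => ∫ s in (0 : ℝ)..t, η s) = η := by
  obtain ⟨hs, hc, ht⟩ := hη
  have hd : ∀ t, HasDerivAt (fun t => ∫ s in (0 : ℝ)..t, η s) (η t) t := fun t =>
    hs.continuous.integral_hasStrictDerivAt 0 t |>.hasDerivAt
  have hderiv : deriv (fun t => ∫ s in (0 : ℝ)..t, η s) = η := funext fun t => (hd t).deriv
  obtain ⟨a, b, ha, hb, hab⟩ := exists_Icc_subset_of_isCompact hT hc ht
  have hz : ∀ t, t ∉ Icc a b → η t = 0 := fun t h => image_eq_zero_of_notMem_tsupport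
    fun h' => h (hab h')
  have hII : ∀ x y : ℝ, IntervalIntegrable η volume x y := fun x y =>
    hs.continuous.intervalIntegrable x y
  have hsupp : Function.support (fun t => ∫ s in (0 : ℝ)..t, η s) ⊆ Icc a b := by
    intro t ht
    by_contra hn
    apply ht
    rw [mem_Icc, not_and_or, not_le, not_le] at hn
    rcases hn with hn | hn
    · refine intervalIntegral.integral_zero_ae (Eventually.of_forall fun s hs => hz s fun h => ?_)
      rcases le_total 0 t with h' | h'
      · rw [uIoc_of_le h'] at hs; linarith [hs.2, h.1]
      · rw [uIoc_of_ge h'] at hs; linarith [hs.2, h.1]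
    · change ∫ s in (0 : ℝ)..t, η s = 0
      -- To the right of `b` the vanishing total integral is what kills the primitive: only the
      -- integral from `T` to `t` is left, and `η` is zero there.
      rw [← intervalIntegral.integral_add_adjacent_intervals (hII 0 T) (hII T t), h0, zero_add]
      refine intervalIntegral.integral_zero_ae (Eventually.of_forall fun s hs => hz s fun h => ?_)
      rcases le_total T t with h' | h'
      · rw [uIoc_of_le h'] at hs; linarith [hs.1, h.2]
      · rw [uIoc_of_ge h'] at hs; linarith [hs.1, h.2]
  have htsupp : tsupport (fun t => ∫ s in (0 : ℝ)..t, η s) ⊆ Icc a b :=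
    closure_minimal hsupp isClosed_Icc
  refine ⟨⟨?_, ?_, ?_⟩, hderiv⟩
  · rw [contDiff_infty_iff_deriv, hderiv]
    exact ⟨fun t => (hd t).differentiableAt, hs⟩
  · exact IsCompact.of_isClosed_subset isCompact_Icc (isClosed_tsupport _) htsupp
  · exact htsupp.trans fun x hx => ⟨by linarith [hx.1], by linarith [hx.2]⟩

theorem exists_isTestFunction_integral_eq_one {T : ℝ} (hT : 0 < T) :
    ∃ χ : ℝ → ℝ, IsTestFunction (Ioo 0 T) χ ∧ ∫ t, χ t = 1 := by
  -- The outer radius `T / 4` keeps the support in `[T / 4, 3 * T / 4]`.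
  let χ : ContDiffBump (T / 2 : ℝ) := ⟨T / 8, T / 4, by positivity, by linarith⟩
  refine ⟨χ.normed volume, ⟨χ.contDiff_normed, χ.hasCompactSupport_normed, ?_⟩, χ.integral_normed⟩
  rw [χ.tsupport_normed_eq, Real.closedBall_eq_Icc]
  intro x hx
  have h1 := hx.1
  have h2 := hx.2
  simp only [χ] at h1 h2
  constructor <;> linarith

/-- Integration by parts of a test function against a primitive. -/
theorem integral_deriv_smul_primitive [CompleteSpace F] {T : ℝ} {f : ℝ → F}
    (hf : IntegrableOn f (Ioo 0 T)) {φ : ℝ → ℝ} (hφ : IsTestFunction (Ioo 0 T) φ) :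
    ∫ t in Ioo 0 T, deriv φ t • ∫ s in (0 : ℝ)..t, f s = - ∫ t in Ioo 0 T, φ t • f t := by
  obtain ⟨hs, hc, ht⟩ := hφ
  have hφT : φ T = 0 := image_eq_zero_of_notMem_tsupport fun h => (ht h).2.false
  have hdc : Continuous (deriv φ) := hs.continuous_deriv (by simp)
  set μ := volume.restrict (Ioo (0 : ℝ) T) with hμ
  have hdi : Integrable (deriv φ) μ := (hdc.integrable_of_hasCompactSupport hc.deriv).integrableOn
  -- Fubini on the triangle `s < t`: integrating `deriv φ` over `(s, T)` gives `-φ s`, because `φ T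
  -- = 0`.
  have hprod : Integrable (Function.uncurry fun t s : ℝ =>
      (Iio t).indicator (fun s => deriv φ t • f s) s)
      (μ.prod μ) := by
    have h1 : Integrable (fun z : ℝ × ℝ => deriv φ z.1 • f z.2) (μ.prod μ) := hdi.smul_prod hf
    have h2 := h1.indicator (s := {z : ℝ × ℝ | z.2 < z.1})
      (measurableSet_lt measurable_snd measurable_fst)
    refine h2.congr (Eventually.of_forall fun z => ?_)
    simp [Function.uncurry, indicator]
  have e1 : ∀ t ∈ Ioo 0 T, deriv φ t • ∫ s in (0 : ℝ)..t, f s =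
      ∫ s, (Iio t).indicator (fun s => deriv φ t • f s) s ∂μ := by
    intro t ht
    rw [integral_indicator measurableSet_Iio, integral_smul, hμ,
      Measure.restrict_restrict measurableSet_Iio,
      intervalIntegral.integral_of_le ht.1.le, integral_Ioc_eq_integral_Ioo]
    congr 3
    ext x
    simp only [mem_inter_iff, mem_Iio, mem_Ioo]
    exact ⟨fun h => ⟨h.2, h.1, h.2.trans ht.2⟩, fun h => ⟨h.2.1, h.1⟩⟩
  have e2 : ∀ s ∈ Ioo 0 T, ∫ t, (Iio t).indicator (fun s => deriv φ t • f s) s ∂μ =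
      - (φ s • f s) := by
    intro s hsm
    have : (fun t => (Iio t).indicator (fun s => deriv φ t • f s) s) =
        (Ioi s).indicator fun t => deriv φ t • f s := by
      ext t; simp [indicator]
    rw [this, integral_indicator measurableSet_Ioi, integral_smul_const, hμ,
      Measure.restrict_restrict measurableSet_Ioi]
    have : Ioi s ∩ Ioo 0 T = Ioo s T := by
      ext x
      simp only [mem_inter_iff, mem_Ioi, mem_Ioo]
      exact ⟨fun h => ⟨h.1, h.2.2⟩, fun h => ⟨h.1, hsm.1.trans h.1, h.2⟩⟩
    rw [this, ← integral_Ioc_eq_integral_Ioo, ← intervalIntegral.integral_of_le hsm.2.le,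
      intervalIntegral.integral_deriv_eq_sub
        (fun x _ => (hs.differentiable (by simp)).differentiableAt)
        (hdc.intervalIntegrable _ _), hφT, zero_sub, neg_smul]
  rw [setIntegral_congr_fun measurableSet_Ioo e1, integral_integral_swap hprod,
    setIntegral_congr_fun measurableSet_Ioo e2, integral_neg]

/-- A function with an integrable weak derivative is a.e. equal to a primitive of it. -/
theorem ae_eq_add_primitive_of_weakDeriv [CompleteSpace F] {T : ℝ} (hT : 0 < T) {x f : ℝ → F}
    (hx : IntegrableOn x (Ioo 0 T)) (hf : IntegrableOn f (Ioo 0 T))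
    (hxf : ∀ φ : ℝ → ℝ, IsTestFunction (Ioo 0 T) φ →
      ∫ t in Ioo 0 T, deriv φ t • x t = - ∫ t in Ioo 0 T, φ t • f t) :
    ∃ a, ∀ᵐ t ∂volume.restrict (Ioo 0 T), x t = a + ∫ s in (0 : ℝ)..t, f s := by
  obtain ⟨χ, hχ, hχ1⟩ := exists_isTestFunction_integral_eq_one hT
  have hfI : IntegrableOn f (Icc 0 T) := by rwa [integrableOn_Icc_iff_integrableOn_Ioo]
  have hprimc : ContinuousOn (fun t => ∫ s in (0 : ℝ)..t, f s) (Icc 0 T) :=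
    intervalIntegral.continuousOn_primitive_interval (by rwa [uIcc_of_le hT.le])
      |>.mono (by rw [uIcc_of_le hT.le])
  have hprim : IntegrableOn (fun t => ∫ s in (0 : ℝ)..t, f s) (Ioo 0 T) :=
    (hprimc.integrableOn_Icc).mono_set Ioo_subset_Icc_self
  -- The difference `y` has zero weak derivative. It remains to see that it is constant, and testing
  -- with the unit mass `χ` shows what the constant must be.
  set y : ℝ → F := fun t => x t - ∫ s in (0 : ℝ)..t, f s with hy
  have hyi : IntegrableOn y (Ioo 0 T) := hx.sub hprim
  have hmul : ∀ (η : ℝ → ℝ) (z : ℝ → F), Continuous η → HasCompactSupport η →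
      IntegrableOn z (Ioo 0 T) → IntegrableOn (fun t => η t • z t) (Ioo 0 T) := by
    intro η z h1 h2 hz
    obtain ⟨C, hC⟩ := h1.bounded_above_of_compact_support h2
    exact hz.bdd_smul C h1.aestronglyMeasurable (Eventually.of_forall hC)
  have hy0 : ∀ φ : ℝ → ℝ, IsTestFunction (Ioo 0 T) φ → ∫ t in Ioo 0 T, deriv φ t • y t = 0 := by
    intro φ hφ
    have hdc : Continuous (deriv φ) := hφ.1.continuous_deriv (by simp)
    simp only [hy, smul_sub]
    rw [integral_sub (hmul _ _ hdc hφ.2.1.deriv hx) (hmul _ _ hdc hφ.2.1.deriv hprim), hxf φ hφ,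
      integral_deriv_smul_primitive hf hφ, sub_self]
  set a : F := ∫ t in Ioo 0 T, χ t • y t with ha
  refine ⟨a, ?_⟩
  have key : ∀ᵐ t ∂volume, t ∈ Ioo 0 T → y t - a = 0 := by
    refine isOpen_Ioo.ae_eq_zero_of_integral_contDiff_smul_eq_zero
      ((hyi.sub (integrableOn_const (by simp))).locallyIntegrableOn) ?_
    intro ψ h1 h2 h3
    -- Subtracting `c • χ` makes the integral of `ψ` vanish, so `ψ - c χ` is the derivative of a
    -- test function and `y` annihilates it.
    set c : ℝ := ∫ t, ψ t with hc
    have hη : IsTestFunction (Ioo 0 T) (fun t => ψ t - c * χ t) := by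
      refine ⟨h1.sub (contDiff_const.mul hχ.1), h2.sub (hχ.2.1.mul_left), ?_⟩
      refine (tsupport_sub _ _).trans (union_subset h3 ?_)
      exact (tsupport_mul_subset_right).trans hχ.2.2
    have hfull : ∀ η : ℝ → ℝ, IsTestFunction (Ioo 0 T) η → ∫ t in (0 : ℝ)..T, η t = ∫ t, η t := by
      intro η hη
      rw [intervalIntegral.integral_of_le hT.le, integral_Ioc_eq_integral_Ioo]
      exact setIntegral_eq_integral_of_forall_compl_eq_zero fun t ht =>
        image_eq_zero_of_notMem_tsupport fun h => ht (hη.2.2 h)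
    have hψi := h1.continuous.integrable_of_hasCompactSupport (μ := volume) h2
    have hχi := hχ.1.continuous.integrable_of_hasCompactSupport (μ := volume) hχ.2.1
    have h0 : ∫ t in (0 : ℝ)..T, (ψ t - c * χ t) = 0 := by
      rw [hfull _ hη, integral_sub hψi (hχi.const_mul c), integral_const_mul, hχ1, mul_one, sub_self]
    obtain ⟨hφ, hφd⟩ := isTestFunction_primitive hT hη h0
    have h4 := hy0 _ hφ
    rw [hφd] at h4
    have h5 : ∫ t in Ioo 0 T, (ψ t - c * χ t) • y t =
        (∫ t in Ioo 0 T, ψ t • y t) - c • a := by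
      simp only [sub_smul, mul_smul]
      have h7 : IntegrableOn (fun t => c • χ t • y t) (Ioo 0 T) :=
        (hmul _ _ hχ.1.continuous hχ.2.1 hyi).smul c
      rw [integral_sub (hmul _ _ h1.continuous h2 hyi) h7, integral_smul]
    have h6 : ∫ t, ψ t • (y t - a) = ∫ t in Ioo 0 T, ψ t • (y t - a) :=
      (setIntegral_eq_integral_of_forall_compl_eq_zero fun t ht => by
        rw [image_eq_zero_of_notMem_tsupport fun h => ht (h3 h), zero_smul]).symm
    rw [h6]
    simp only [smul_sub]
    rw [integral_sub (hmul _ _ h1.continuous h2 hyi) (hψi.integrableOn.smul_const a),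
      integral_smul_const, ← integral_Ioc_eq_integral_Ioo (f := ψ),
      ← intervalIntegral.integral_of_le hT.le, hfull ψ ⟨h1, h2, h3⟩, ← hc, ← h5, h4]
  rw [ae_restrict_iff' measurableSet_Ioo]
  filter_upwards [key] with t ht htm
  have := ht htm
  rw [sub_eq_zero] at this
  rw [← this, hy]; simp

end WeakDerivative

/-! ### The product rule by translation and Steklov averages -/

section ProductRule

theorem memLp_comp_add_right {X : Type*} [NormedAddCommGroup X] {f : ℝ → X}
    (hf : MemLp f 2 volume) (α : ℝ) : MemLp (fun t => f (t + α)) 2 volume :=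
  hf.comp_measurePreserving (measurePreserving_add_right volume α)

theorem intervalIntegrable_of_memLp {X : Type*} [NormedAddCommGroup X] {f : ℝ → X}
    (hf : MemLp f 2 volume) (x y : ℝ) : IntervalIntegrable f volume x y := by
  have : IsFiniteMeasure (volume.restrict (uIoc x y)) := ⟨by simp [uIoc]⟩
  rw [intervalIntegrable_iff]
  exact (hf.restrict (uIoc x y)).integrable one_le_two

theorem stronglyMeasurable_indicator_Lp {X : Type*} [NormedAddCommGroup X] {T : ℝ}
    (w : L2Time T X) : StronglyMeasurable ((Ioo 0 T).indicator w) :=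
  (Lp.stronglyMeasurable w).indicator measurableSet_Ioo

theorem memLp_indicator_Lp {X : Type*} [NormedAddCommGroup X] {T : ℝ}
    (w : L2Time T X) : MemLp ((Ioo 0 T).indicator w) 2 volume :=
  (memLp_indicator_iff_restrict measurableSet_Ioo).2 (Lp.memLp w)

/-- Continuity of translations in `L²(ℝ)`. -/
theorem continuous_translate {X : Type*} [NormedAddCommGroup X] {f : ℝ → X}
    (hf : MemLp f 2 volume) :
    Continuous fun α : ℝ => (memLp_comp_add_right hf α).toLp := by
  have : Fact ((2 : ℝ≥0∞) ≠ ⊤) := ⟨by simp⟩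
  have h : Continuous fun α : ℝ => DomAddAct.mk α +ᵥ hf.toLp :=
    (DomAddAct.continuous_mk).vadd continuous_const
  refine h.congr fun α => ?_
  rw [DomAddAct.mk_vadd_toLp]
  congr 1
  ext t
  simp [add_comm]

variable {E F G : Type*} [NormedAddCommGroup E] [NormedSpace ℝ E] [NormedAddCommGroup F]
  [NormedSpace ℝ F] [NormedAddCommGroup G] [NormedSpace ℝ G]

/-- Both translates depend continuously on the shift in `L²`, the Hölder pairing `L² × L² → L¹` is
continuous, and so is integration over `S` on `L¹`. -/
theorem continuous_integral_translate (B : F →L[ℝ] E →L[ℝ] G) {f : ℝ → F} {v : ℝ → E}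
    (hf : MemLp f 2 volume) (hv : MemLp v 2 volume) (S : Set ℝ) :
    Continuous fun z : ℝ × ℝ => ∫ t in S, B (f (t + z.1)) (v (t + z.2)) := by
  have h : Continuous fun z : ℝ × ℝ => ∫ t in S, (B.holderL volume 2 2 1
      (memLp_comp_add_right hf z.1).toLp (memLp_comp_add_right hv z.2).toLp : ℝ → G) t := by
    refine (continuous_setIntegral (μ := volume) (E := G) S).comp ?_
    exact (((B.holderL volume 2 2 1).continuous.comp
      ((continuous_translate hf).comp continuous_fst)).clm_apply
      ((continuous_translate hv).comp continuous_snd))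
  refine h.congr fun z => integral_congr_ae (ae_restrict_of_ae ?_)
  rw [ContinuousLinearMap.holderL_apply_apply]
  filter_upwards [B.coeFn_holder (r := 1) (memLp_comp_add_right hf z.1).toLp
    (memLp_comp_add_right hv z.2).toLp, (memLp_comp_add_right hf z.1).coeFn_toLp,
    (memLp_comp_add_right hv z.2).coeFn_toLp] with t h1 h2 h3
  rw [h1, h2, h3]

theorem integrable_bilin (B : F →L[ℝ] E →L[ℝ] G) {f : ℝ → F} {v : ℝ → E} {μ : Measure ℝ}
    (hf : MemLp f 2 μ) (hv : MemLp v 2 μ) : Integrable (fun t => B (f t) (v t)) μ :=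
  memLp_one_iff_integrable.1 (B.memLp_of_bilin 1 hf hv)

/-- Justifies exchanging the average in `σ` with the integral in `t`: by translation invariance the
inner integral of the norm is bounded uniformly in `σ`. Strong measurability, rather than its a.e.
version, makes joint measurability in `(t, σ)` immediate. -/
theorem integrable_prod_translate (B : F →L[ℝ] E →L[ℝ] G) {f : ℝ → F} {v : ℝ → E}
    (hfm : StronglyMeasurable f) (hvm : StronglyMeasurable v)
    (hf : MemLp f 2 volume) (hv : MemLp v 2 volume) (S : Set ℝ) (h β : ℝ) :
    Integrable (Function.uncurry fun t σ : ℝ => B (f (t + h * σ)) (v (t + β * h)))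
      ((volume.restrict S).prod (volume.restrict (Ioc (0 : ℝ) 1))) := by
  have hm : StronglyMeasurable
      (Function.uncurry fun t σ : ℝ => B (f (t + h * σ)) (v (t + β * h))) := by
    have h1 : StronglyMeasurable fun z : ℝ × ℝ => f (z.1 + h * z.2) :=
      hfm.comp_measurable (by fun_prop)
    have h2 : StronglyMeasurable fun z : ℝ × ℝ => v (z.1 + β * h) :=
      hvm.comp_measurable (by fun_prop)
    exact B.continuous₂.comp_stronglyMeasurable (h1.prodMk h2)
  rw [integrable_prod_iff' hm.aestronglyMeasurable]
  have hf2 := (memLp_two_iff_integrable_sq_norm hf.1).1 hf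
  have hv2 := (memLp_two_iff_integrable_sq_norm hv.1).1 hv
  refine ⟨Eventually.of_forall fun σ => (integrable_bilin B (memLp_comp_add_right hf (h * σ))
    (memLp_comp_add_right hv (β * h))).integrableOn, ?_⟩
  refine Integrable.of_bound (C := ‖B‖ * ((∫ t, ‖f t‖ ^ 2) + ∫ t, ‖v t‖ ^ 2))
    (hm.norm.integral_prod_left').aestronglyMeasurable (Eventually.of_forall fun σ => ?_)
  rw [Real.norm_of_nonneg (integral_nonneg fun _ => norm_nonneg _)]
  have e1 : Integrable (fun t => ‖f (t + h * σ)‖ ^ 2) := hf2.comp_add_right _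
  have e2 : Integrable (fun t => ‖v (t + β * h)‖ ^ 2) := hv2.comp_add_right _
  have e3 : Integrable (fun t => ‖B (f (t + h * σ)) (v (t + β * h))‖) :=
    (integrable_bilin B (memLp_comp_add_right hf _) (memLp_comp_add_right hv _)).norm
  calc ∫ t in S, ‖B (f (t + h * σ)) (v (t + β * h))‖
      ≤ ∫ t, ‖B (f (t + h * σ)) (v (t + β * h))‖ :=
        setIntegral_le_integral e3 (Eventually.of_forall fun _ => norm_nonneg _)
    _ ≤ ∫ t, ‖B‖ * (‖f (t + h * σ)‖ ^ 2 + ‖v (t + β * h)‖ ^ 2) := by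
        refine integral_mono e3 ((e1.add e2).const_mul _) fun t => ?_
        refine (B.le_opNorm₂ _ _).trans ?_
        rw [mul_assoc]
        refine mul_le_mul_of_nonneg_left ?_ (norm_nonneg B)
        nlinarith [sq_nonneg (‖f (t + h * σ)‖ - ‖v (t + β * h)‖), sq_nonneg (‖f (t + h * σ)‖),
          sq_nonneg ‖v (t + β * h)‖]
    _ = _ := by
        rw [integral_const_mul, integral_add e1 e2,
          integral_add_right_eq_self (fun t => ‖f t‖ ^ 2),
          integral_add_right_eq_self (fun t => ‖v t‖ ^ 2)]

/-- Steklov averages converge, tested against translates. -/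
theorem tendsto_integral_steklov [CompleteSpace F] [CompleteSpace G]
    (B : F →L[ℝ] E →L[ℝ] G) {f : ℝ → F} {v : ℝ → E}
    (hfm : StronglyMeasurable f) (hvm : StronglyMeasurable v)
    (hf : MemLp f 2 volume) (hv : MemLp v 2 volume) (S : Set ℝ) (β : ℝ) :
    Tendsto (fun h : ℝ => ∫ t in S, B (∫ σ in (0 : ℝ)..1, f (t + h * σ)) (v (t + β * h)))
      (𝓝[>] 0) (𝓝 (∫ t in S, B (f t) (v t))) := by
  -- With the integrals exchanged, the expression is continuous in `h`, and at `h = 0` its integrand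
  -- no longer depends on `σ`.
  have hc : Continuous fun h : ℝ => ∫ σ in (0 : ℝ)..1,
      ∫ t in S, B (f (t + h * σ)) (v (t + β * h)) := by
    refine intervalIntegral.continuous_parametric_intervalIntegral_of_continuous'
      (f := fun h σ : ℝ => ∫ t in S, B (f (t + h * σ)) (v (t + β * h))) ?_ 0 1
    exact (continuous_integral_translate B hf hv S).comp
      (g := fun z : ℝ × ℝ => ∫ t in S, B (f (t + z.1)) (v (t + z.2)))
      (f := fun z : ℝ × ℝ => (z.1 * z.2, β * z.1)) (by fun_prop)
  have h0 := (hc.tendsto 0).mono_left (nhdsWithin_le_nhds (s := Ioi 0))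
  simp only [zero_mul, mul_zero, add_zero, intervalIntegral.integral_const, sub_zero, one_smul]
    at h0
  refine h0.congr' ?_
  filter_upwards [self_mem_nhdsWithin] with h hh
  have hh' : h ≠ 0 := ne_of_gt hh
  rw [intervalIntegral.integral_of_le zero_le_one,
    ← integral_integral_swap (integrable_prod_translate B hfm hvm hf hv S h β)]
  congr 1
  ext t
  have hfi : IntervalIntegrable (fun σ => f (t + h * σ)) volume 0 1 := by
    have h1 : IntervalIntegrable f volume (t + h * 0) (t + h * 1) :=
      intervalIntegrable_of_memLp hf _ _
    have h2 := (h1.comp_add_left t).comp_mul_left (c := h)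
    simpa [hh'] using h2
  rw [← intervalIntegral.integral_of_le zero_le_one]
  exact (B.flip (v (t + β * h))).intervalIntegral_comp_comm hfi

/-- Neither factor need be differentiable in `E`, so the increment of `p` between two points where
its primitive is differentiable is computed as the limit of the integrals over `(s, r]` of the
difference quotients of `p`. -/
theorem product_rule_aux [CompleteSpace F] [CompleteSpace G] (B : F →L[ℝ] E →L[ℝ] G)
    (D : E →L[ℝ] F) (hD : ∀ x y, B (D x) y = B (D y) x) {T : ℝ} (hT : 0 < T)
    {u v : ℝ → E} {f g : ℝ → F}
    (hum : StronglyMeasurable u) (hvm : StronglyMeasurable v)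
    (hfm : StronglyMeasurable f) (hgm : StronglyMeasurable g)
    (hu : MemLp u 2 volume) (hv : MemLp v 2 volume) (hf : MemLp f 2 volume)
    (hg : MemLp g 2 volume) {a b : F}
    (huf : ∀ᵐ t, t ∈ Ioo 0 T → D (u t) = a + ∫ s in (0 : ℝ)..t, f s)
    (hvg : ∀ᵐ t, t ∈ Ioo 0 T → D (v t) = b + ∫ s in (0 : ℝ)..t, g s) :
    ∃ c, ∀ᵐ t, t ∈ Ioo 0 T → B (D (u t)) (v t) =
      c + ∫ s in (0 : ℝ)..t, (B (f s) (v s) + B (g s) (u s)) := by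
  set p : ℝ → G := fun t => B (D (u t)) (v t) with hp
  set q : ℝ → G := fun s => B (f s) (v s) + B (g s) (u s) with hq
  have hpi : Integrable p := integrable_bilin B (D.comp_memLp' hu) hv
  have hqi1 : Integrable fun s => B (f s) (v s) := integrable_bilin B hf hv
  have hqi2 : Integrable fun s => B (g s) (u s) := integrable_bilin B hg hu
  have hqi : Integrable q := hqi1.add hqi2
  have hLI : ∀ {k : ℝ → F}, MemLp k 2 volume → ∀ x y, IntervalIntegrable k volume x y :=
    fun hk x y => intervalIntegrable_of_memLp hk x y
  have hshift : ∀ {P : ℝ → Prop}, (∀ᵐ t, P t) → ∀ h : ℝ, ∀ᵐ t : ℝ, P (t + h) :=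
    fun hP h => (measurePreserving_add_right volume h).quasiMeasurePreserving.ae hP
  have hincr : ∀ (w : ℝ → E) (k : ℝ → F) (d : F), MemLp k 2 volume →
      (∀ᵐ t, t ∈ Ioo 0 T → D (w t) = d + ∫ s in (0 : ℝ)..t, k s) → ∀ h : ℝ,
      ∀ᵐ t, t ∈ Ioo 0 T → t + h ∈ Ioo 0 T →
        D (w (t + h)) - D (w t) = h • ∫ σ in (0 : ℝ)..1, k (t + h * σ) := by
    intro w k d hk hw h
    filter_upwards [hw, hshift hw h] with t h1 h2 ht hth
    rw [h1 ht, h2 hth, intervalIntegral.smul_integral_comp_add_mul, add_sub_add_left_eq_sub,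
      intervalIntegral.integral_interval_sub_left (hLI hk _ _) (hLI hk _ _)]
    simp
  have key : ∀ s r, 0 < s → s ≤ r → r < T →
      (∀ c, HasDerivAt (fun x => ∫ t in c..x, p t) (p s) s) →
      (∀ c, HasDerivAt (fun x => ∫ t in c..x, p t) (p r) r) →
      p r - p s = ∫ t in s..r, q t := by
    intro s r hs hsr hr hds hdr
    have l1 : Tendsto (fun h : ℝ => h⁻¹ • ((∫ t in (0 : ℝ)..(r + h), p t) -
        (∫ t in (0 : ℝ)..r, p t)) - h⁻¹ • ((∫ t in (0 : ℝ)..(s + h), p t) -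
        (∫ t in (0 : ℝ)..s, p t))) (𝓝[>] 0) (𝓝 (p r - p s)) :=
      ((hdr 0).tendsto_slope_zero_right).sub ((hds 0).tendsto_slope_zero_right)
    -- The discrete product rule evaluates `v` at `t + h` and `u` at `t`, hence the shifts `1` and
    -- `0`.
    have l2 := (tendsto_integral_steklov B hfm hvm hf hv (Ioc s r) 1).add
      (tendsto_integral_steklov B hgm hum hg hu (Ioc s r) 0)
    rw [← integral_add hqi1.integrableOn hqi2.integrableOn,
      ← intervalIntegral.integral_of_le hsr] at l2
    refine tendsto_nhds_unique l1 (l2.congr' ?_)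
    -- For `h < T - r` the shifted times stay in `(0, T)`, where the primitive formulas hold.
    have hmem : Ioo (0 : ℝ) (T - r) ∈ 𝓝[>] (0 : ℝ) := Ioo_mem_nhdsGT (by linarith)
    filter_upwards [hmem] with h hh
    have hh0 : h ≠ 0 := hh.1.ne'
    have hpI : ∀ x y, IntervalIntegrable p volume x y := fun x y => hpi.intervalIntegrable
    have hpI' : ∀ x y, IntervalIntegrable (fun t => p (t + h)) volume x y :=
      fun x y => (hpi.comp_add_right h).intervalIntegrable
    have hsplit : (∫ t in (0 : ℝ)..(r + h), p t) - (∫ t in (0 : ℝ)..r, p t) -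
        ((∫ t in (0 : ℝ)..(s + h), p t) - (∫ t in (0 : ℝ)..s, p t)) =
        ∫ t in Ioc s r, (p (t + h) - p t) := by
      rw [← intervalIntegral.integral_of_le hsr, intervalIntegral.integral_sub (hpI' _ _) (hpI _ _),
        intervalIntegral.integral_comp_add_right, sub_sub_sub_comm,
        intervalIntegral.integral_interval_sub_left (hpI _ _) (hpI _ _),
        intervalIntegral.integral_interval_sub_left (hpI _ _) (hpI _ _)]
    have hpt : ∀ᵐ t ∂volume.restrict (Ioc s r), h⁻¹ • (p (t + h) - p t) =
        B (∫ σ in (0 : ℝ)..1, f (t + h * σ)) (v (t + 1 * h)) +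
        B (∫ σ in (0 : ℝ)..1, g (t + h * σ)) (u (t + 0 * h)) := by
      rw [ae_restrict_iff' measurableSet_Ioc]
      filter_upwards [hincr u f a hf huf h, hincr v g b hg hvg h] with t h1 h2 ht
      have m1 : t ∈ Ioo 0 T := ⟨hs.trans ht.1, ht.2.trans_lt hr⟩
      have m2 : t + h ∈ Ioo 0 T := ⟨by linarith [m1.1, hh.1], by linarith [ht.2, hh.2]⟩
      -- Discrete Leibniz rule; symmetry of `D` moves the second increment from `v` onto `D v`.
      have e : p (t + h) - p t = B (D (u (t + h)) - D (u t)) (v (t + h)) +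
          B (D (v (t + h)) - D (v t)) (u t) := by
        simp only [hp, map_sub, sub_apply]
        rw [hD (v (t + h)) (u t), hD (v t) (u t)]
        abel
      rw [e, h1 m1 m2, h2 m1 m2]
      simp [hh0]
    have hi : ∀ {k : ℝ → F} {w : ℝ → E} (β : ℝ), StronglyMeasurable k → StronglyMeasurable w →
        MemLp k 2 volume → MemLp w 2 volume → IntegrableOn
          (fun t => B (∫ σ in (0 : ℝ)..1, k (t + h * σ)) (w (t + β * h))) (Ioc s r) := by
      intro k w β h1 h2 h3 h4
      refine (integrable_prod_translate B h1 h2 h3 h4 (Ioc s r) h β).integral_prod_left.congr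
        (Eventually.of_forall fun t => ?_)
      have hfi : IntervalIntegrable (fun σ => k (t + h * σ)) volume 0 1 := by
        have h1 : IntervalIntegrable k volume (t + h * 0) (t + h * 1) := hLI h3 _ _
        have h2 := (h1.comp_add_left t).comp_mul_left (c := h)
        simpa [hh0] using h2
      simp only [Function.uncurry]
      rw [← intervalIntegral.integral_of_le zero_le_one]
      exact (B.flip (w (t + β * h))).intervalIntegral_comp_comm hfi
    rw [← smul_sub, hsplit, ← integral_smul, integral_congr_ae hpt,
      integral_add (hi 1 hfm hvm hf hv) (hi 0 hgm hum hg hu)]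
  have hder := LocallyIntegrable.ae_hasDerivAt_integral hpi.locallyIntegrable
  have hqI : ∀ x y, IntervalIntegrable q volume x y := fun x y => hqi.intervalIntegrable
  obtain ⟨s₀, hs₀, hds₀⟩ : ∃ s ∈ Ioo 0 T, ∀ c, HasDerivAt (fun x => ∫ t in c..x, p t) (p s) s := by
    by_contra! hcon
    have h0 : volume (Ioo 0 T) = 0 :=
      measure_mono_null (t := {s | ¬ ∀ c, HasDerivAt (fun x => ∫ t in c..x, p t) (p s) s})
        (fun s hs => by simpa using hcon s hs) hder
    simp [hT.not_ge] at h0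
  refine ⟨p s₀ - ∫ t in (0 : ℝ)..s₀, q t, ?_⟩
  filter_upwards [hder] with t ht htm
  have e : p t - p s₀ = ∫ x in s₀..t, q x := by
    rcases le_total s₀ t with h | h
    · exact key s₀ t hs₀.1 h htm.2 hds₀ ht
    · rw [intervalIntegral.integral_symm, ← key t s₀ htm.1 h hs₀.2 ht hds₀, neg_sub]
  rw [← intervalIntegral.integral_interval_sub_left (hqI 0 t) (hqI 0 s₀)] at e
  change p t = _
  rw [eq_add_of_sub_eq e]
  abel

theorem intervalIntegral_indicator_Ioo {T t : ℝ} (ht : t ∈ Icc 0 T) (f : ℝ → F) :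
    ∫ s in (0 : ℝ)..t, (Ioo 0 T).indicator f s = ∫ s in (0 : ℝ)..t, f s := by
  rw [intervalIntegral.integral_of_le ht.1, intervalIntegral.integral_of_le ht.1,
    integral_Ioc_eq_integral_Ioo, integral_Ioc_eq_integral_Ioo]
  refine setIntegral_congr_fun measurableSet_Ioo fun s hs => ?_
  exact indicator_of_mem (s := Ioo 0 T) ⟨hs.1, hs.2.trans_le ht.2⟩ f

/-- The product rule for a continuous bilinear form along functions whose image under a symmetric
map `D` has a square integrable derivative. -/
theorem product_rule [CompleteSpace F] [CompleteSpace G] (B : F →L[ℝ] E →L[ℝ] G)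
    (D : E →L[ℝ] F) (hD : ∀ x y, B (D x) y = B (D y) x) {T : ℝ} (hT : 0 < T)
    (u v : L2Time T E) (f g : L2Time T F) {a b : F}
    (huf : ∀ᵐ t ∂volume.restrict (Ioo 0 T), D (u t) = a + ∫ s in (0 : ℝ)..t, f s)
    (hvg : ∀ᵐ t ∂volume.restrict (Ioo 0 T), D (v t) = b + ∫ s in (0 : ℝ)..t, g s) :
    ∃ c, ∀ᵐ t ∂volume.restrict (Ioo 0 T), B (D (u t)) (v t) =
      c + ∫ s in (0 : ℝ)..t, (B (f s) (v s) + B (g s) (u s)) := by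
  rw [ae_restrict_iff' measurableSet_Ioo] at huf hvg
  -- Extension by zero to the whole line makes the translates meaningful; the primitive formulas are
  -- still only used inside `(0, T)`.
  obtain ⟨c, hc⟩ := product_rule_aux B D hD hT (u := (Ioo 0 T).indicator u)
    (v := (Ioo 0 T).indicator v) (f := (Ioo 0 T).indicator f) (g := (Ioo 0 T).indicator g)
    (a := a) (b := b) (stronglyMeasurable_indicator_Lp u)
    (stronglyMeasurable_indicator_Lp v) (stronglyMeasurable_indicator_Lp f)
    (stronglyMeasurable_indicator_Lp g) (memLp_indicator_Lp u) (memLp_indicator_Lp v)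
    (memLp_indicator_Lp f) (memLp_indicator_Lp g)
    (by
      filter_upwards [huf] with t ht htm
      rw [indicator_of_mem htm, intervalIntegral_indicator_Ioo (Ioo_subset_Icc_self htm), ht htm])
    (by
      filter_upwards [hvg] with t ht htm
      rw [indicator_of_mem htm, intervalIntegral_indicator_Ioo (Ioo_subset_Icc_self htm), ht htm])
  refine ⟨c, ?_⟩
  rw [ae_restrict_iff' measurableSet_Ioo]
  filter_upwards [hc] with t ht htm
  have := ht htm
  rw [indicator_of_mem htm, indicator_of_mem htm] at this
  rw [this, ← intervalIntegral_indicator_Ioo (Ioo_subset_Icc_self htm)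
    (fun s => B (f s) (v s) + B (g s) (u s))]
  congr 2
  ext s
  by_cases hs : s ∈ Ioo 0 T <;> simp [hs]

end ProductRule

/-! ### Energy identity and continuity in the pivot space -/

section Continuity

theorem intervalIntegrable_of_integrableOn_Ioo {X : Type*} [NormedAddCommGroup X] {T x y : ℝ}
    {f : ℝ → X} (hf : IntegrableOn f (Ioo 0 T)) (hx : x ∈ Icc 0 T) (hy : y ∈ Icc 0 T) :
    IntervalIntegrable f volume x y := by
  rw [← integrableOn_Icc_iff_integrableOn_Ioo] at hf
  exact (hf.mono_set (uIcc_subset_Icc hx hy)).intervalIntegrable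

theorem continuousOn_primitive_Icc {X : Type*} [NormedAddCommGroup X] [NormedSpace ℝ X] {T : ℝ}
    (hT : 0 < T) {f : ℝ → X} (hf : IntegrableOn f (Ioo 0 T)) :
    ContinuousOn (fun t => ∫ s in (0 : ℝ)..t, f s) (Icc 0 T) := by
  have h := intervalIntegral.continuousOn_primitive_interval (a := 0) (b := T) (f := f)
    (μ := volume) (by rwa [uIcc_of_le hT.le, integrableOn_Icc_iff_integrableOn_Ioo])
  rwa [uIcc_of_le hT.le] at h

/-- Continuous functions on `[0, T]` that agree almost everywhere agree everywhere, so the formula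
may be evaluated at the endpoints. -/
theorem sub_eq_integral_of_ae_eq_primitive {X : Type*} [NormedAddCommGroup X] [NormedSpace ℝ X]
    {T : ℝ} (hT : 0 < T) {p q : ℝ → X} {c : X}
    (hp : ContinuousOn p (Icc 0 T)) (hq : IntegrableOn q (Ioo 0 T))
    (h : ∀ᵐ t ∂volume.restrict (Ioo 0 T), p t = c + ∫ s in (0 : ℝ)..t, q s) :
    p T - p 0 = ∫ t in Ioo 0 T, q t := by
  have h' : p =ᵐ[volume.restrict (Icc 0 T)] fun t => c + ∫ s in (0 : ℝ)..t, q s := by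
    rwa [← Measure.restrict_congr_set Ioo_ae_eq_Icc]
  have heq := Measure.eqOn_Icc_of_ae_eq volume hT.ne h' hp
    (continuousOn_const.add (continuousOn_primitive_Icc hT hq))
  rw [heq ⟨hT.le, le_rfl⟩, heq ⟨le_rfl, hT.le⟩]
  simp only [intervalIntegral.integral_same, add_zero, add_sub_cancel_left]
  rw [intervalIntegral.integral_of_le hT.le, integral_Ioc_eq_integral_Ioo]

/-- A function on a dense subset whose oscillation is controlled by a continuous function
extends continuously. -/
theorem continuousOn_extendFrom_of_dist_sq_le {H : Type*} [NormedAddCommGroup H] [CompleteSpace H]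
    {A S : Set ℝ} (hA : A ⊆ S) (hS : S ⊆ closure A) {φ : ℝ → H} {M : ℝ → ℝ}
    (hM : ContinuousOn M S) {K : ℝ}
    (h : ∀ x ∈ A, ∀ y ∈ A, ‖φ x - φ y‖ ^ 2 ≤ K * |M x - M y|) :
    ContinuousOn (extendFrom A φ) S ∧ ∀ x ∈ A, extendFrom A φ x = φ x := by
  have hlim : ∀ x ∈ S, ∃ y, Tendsto φ (𝓝[A] x) (𝓝 y) := by
    intro x hx
    have hne : (𝓝[A] x).NeBot := mem_closure_iff_nhdsWithin_neBot.1 (hS hx)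
    rw [← cauchy_map_iff_exists_tendsto, cauchy_map_iff', tendsto_uniformity_iff_dist_tendsto_zero]
    have hMx : Tendsto M (𝓝[A] x) (𝓝 (M x)) := (hM x hx).mono_left (nhdsWithin_mono _ hA)
    have h1 : Tendsto (fun z : ℝ × ℝ => √(K * |M z.1 - M z.2|)) (𝓝[A] x ×ˢ 𝓝[A] x) (𝓝 0) := by
      have := (((hMx.comp tendsto_fst).sub (hMx.comp tendsto_snd)).abs.const_mul K).sqrt
      simpa using this
    refine squeeze_zero' (Eventually.of_forall fun _ => dist_nonneg) ?_ h1
    filter_upwards [prod_mem_prod self_mem_nhdsWithin self_mem_nhdsWithin] with z hz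
    rw [dist_eq_norm]
    exact Real.le_sqrt_of_sq_le (h z.1 hz.1 z.2 hz.2)
  refine ⟨continuousOn_extendFrom hS hlim, fun x hx => ?_⟩
  obtain ⟨y, hy⟩ := hlim x (hA hx)
  -- Since `x` itself lies in `A`, the limit along `𝓝[A] x` can only be `φ x`.
  have hxy : Tendsto φ (𝓝[A] x) (𝓝 (φ x)) := by
    have h1 : φ x = y := by
      refine tendsto_nhds_unique (tendsto_pure_nhds φ x) (hy.mono_left ?_)
      exact le_inf (pure_le_nhds x) (by simpa using hx)
    rwa [h1]
  exact extendFrom_eq (subset_closure hx) hxy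

variable {𝕜 V H : Type*} [RCLike 𝕜] [NormedAddCommGroup V] [NormedSpace 𝕜 V]
  [NormedAddCommGroup H] [NormedSpace 𝕜 H]

/-- The conjugate of a functional with respect to a conjugation of the underlying space. -/
noncomputable def conjFunctional (C : V →ₗᵢ⋆[𝕜] V) (F : V →L[𝕜] 𝕜) : V →L[𝕜] 𝕜 :=
  LinearMap.mkContinuous
    { toFun := fun w => conj (F (C w))
      map_add' := fun x y => by simp
      map_smul' := fun c x => by simp [C.map_smulₛₗ] } ‖F‖ (fun x => by
        simpa using F.le_opNorm (C x))

@[simp]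
theorem conjFunctional_apply (C : V →ₗᵢ⋆[𝕜] V) (F : V →L[𝕜] 𝕜) (w : V) :
    conjFunctional C F w = conj (F (C w)) := rfl

theorem norm_conjFunctional_le (C : V →ₗᵢ⋆[𝕜] V) (F : V →L[𝕜] 𝕜) : ‖conjFunctional C F‖ ≤ ‖F‖ :=
  LinearMap.mkContinuous_norm_le _ (norm_nonneg F) _

/-- The conjugation of functionals as a real linear operator. -/
noncomputable def dualConj (C : V →ₗᵢ⋆[𝕜] V) : (V →L[𝕜] 𝕜) →L[ℝ] (V →L[𝕜] 𝕜) :=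
  LinearMap.mkContinuous
    { toFun := conjFunctional C
      map_add' := fun F G => by ext; simp
      map_smul' := fun c F => by ext; simp [RCLike.real_smul_eq_coe_mul] } 1
    (fun F => (norm_conjFunctional_le C F).trans_eq (one_mul _).symm)

@[simp]
theorem dualConj_apply (C : V →ₗᵢ⋆[𝕜] V) (F : V →L[𝕜] 𝕜) (w : V) :
    dualConj C F w = conj (F (C w)) := rfl

variable (D : V →L[𝕜] V →L[𝕜] 𝕜) (C : V →ₗᵢ⋆[𝕜] V) (j : V →L[𝕜] H)

/-- Expand `D (x - y) (C (x - y))`. The form is chosen so that `D x - D y`, later an integral of the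
derivative, is paired with `y` alone: only one of the two points needs a bound in `V`. -/
theorem norm_sub_sq_eq (hD : ∀ x y, D x y = D y x) (hDC : ∀ x y, D (C x) y = conj (D x (C y)))
    (hj : ∀ x, D x (C x) = ((‖j x‖ ^ 2 : ℝ) : 𝕜)) (x y : V) :
    ((‖j x - j y‖ ^ 2 : ℝ) : 𝕜) = ((‖j x‖ ^ 2 : ℝ) : 𝕜) - ((‖j y‖ ^ 2 : ℝ) : 𝕜)
      - (D x - D y) (C y) - conj ((D x - D y) (C y)) := by
  have h1 : D y (C x) = conj (D x (C y)) := by rw [hD, hDC]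
  have h2 : conj (D y (C y)) = D y (C y) := by rw [hj, RCLike.conj_ofReal]
  rw [← map_sub, ← hj, ← hj, ← hj]
  simp only [map_sub, sub_apply]
  rw [h1, h2]
  ring

theorem exists_eq_primitive_of_weakDeriv {T : ℝ} (hT : 0 < T) (u : L2Time T V)
    (f : L2Time T (V →L[𝕜] 𝕜))
    (huf : ∀ φ : ℝ → ℝ, IsTestFunction (Ioo 0 T) φ →
      ∫ t in Ioo 0 T, deriv φ t • D (u t) = - ∫ t in Ioo 0 T, φ t • f t) :
    ∃ a, ∀ᵐ t ∂volume.restrict (Ioo 0 T), D (u t) = a + ∫ s in (0 : ℝ)..t, f s :=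
  ae_eq_add_primitive_of_weakDeriv hT (D.integrable_comp ((Lp.memLp u).integrable one_le_two))
    ((Lp.memLp f).integrable one_le_two) huf

variable [NormedSpace ℝ V] [IsScalarTower ℝ 𝕜 V]

/-- Product rule for the duality pairing. -/
theorem product_rule_dual (hD : ∀ x y, D x y = D y x) {T : ℝ} (hT : 0 < T) (u v : L2Time T V)
    (f g : L2Time T (V →L[𝕜] 𝕜)) {a b : V →L[𝕜] 𝕜}
    (huf : ∀ᵐ t ∂volume.restrict (Ioo 0 T), D (u t) = a + ∫ s in (0 : ℝ)..t, f s)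
    (hvg : ∀ᵐ t ∂volume.restrict (Ioo 0 T), D (v t) = b + ∫ s in (0 : ℝ)..t, g s) :
    ∃ c, ∀ᵐ t ∂volume.restrict (Ioo 0 T), D (u t) (v t) =
      c + ∫ s in (0 : ℝ)..t, (f s (v s) + g s (u s)) :=
  product_rule (G := 𝕜) (ContinuousLinearMap.restrictScalarsL 𝕜 V 𝕜 ℝ ℝ)
    (D.restrictScalars ℝ) (fun x y => hD x y) hT u v f g huf hvg

/-- Energy identity. -/
theorem exists_norm_sq_eq_primitive (hD : ∀ x y, D x y = D y x)
    (hDC : ∀ x y, D (C x) y = conj (D x (C y)))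
    (hj : ∀ x, D x (C x) = ((‖j x‖ ^ 2 : ℝ) : 𝕜)) {T : ℝ} (hT : 0 < T) (u : L2Time T V)
    (f : L2Time T (V →L[𝕜] 𝕜)) {a : V →L[𝕜] 𝕜}
    (huf : ∀ᵐ t ∂volume.restrict (Ioo 0 T), D (u t) = a + ∫ s in (0 : ℝ)..t, f s) :
    ∃ c : 𝕜, ∀ᵐ t ∂volume.restrict (Ioo 0 T), ((‖j (u t)‖ ^ 2 : ℝ) : 𝕜) =
      c + ∫ s in (0 : ℝ)..t, (f s (C (u s)) + conj (f s (C (u s)))) := by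
  -- Conjugation is only conjugate-linear over `𝕜`; as a real linear map it acts on `L²(0, T; V)`.
  let Cr : V →L[ℝ] V := LinearMap.mkContinuous
    { toFun := C
      map_add' := map_add C
      map_smul' := fun c x => by
        rw [← algebraMap_smul 𝕜 c x, C.map_smulₛₗ]
        simp } 1 (fun x => by simp)
  have hfi : IntegrableOn f (Ioo 0 T) := (Lp.memLp f).integrable one_le_two
  have hv : ∀ᵐ t ∂volume.restrict (Ioo 0 T), Cr.compLp u t = C (u t) := Cr.coeFn_compLp u
  have hg : ∀ᵐ t ∂volume.restrict (Ioo 0 T), (dualConj C).compLp f t = dualConj C (f t) :=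
    (dualConj C).coeFn_compLp f
  have hmono : ∀ {t}, t ∈ Ioo 0 T → ∀ {P : ℝ → Prop}, (∀ᵐ s ∂volume.restrict (Ioo 0 T), P s) →
      ∀ᵐ s, s ∈ uIoc 0 t → P s := by
    intro t ht P hP
    rw [ae_restrict_iff' measurableSet_Ioo] at hP
    filter_upwards [hP] with s hs hst
    rw [uIoc_of_le ht.1.le] at hst
    exact hs ⟨hst.1, hst.2.trans_lt ht.2⟩
  -- By `hDC`, `D (C u)` is the conjugate of `D u`, hence a primitive of the conjugate of `f`.
  obtain ⟨c, hc⟩ := product_rule_dual D hD hT u (Cr.compLp u) f ((dualConj C).compLp f)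
    (a := a) (b := dualConj C a) huf (by
      filter_upwards [huf, hv, ae_restrict_mem measurableSet_Ioo] with t h1 h2 ht
      rw [intervalIntegral.integral_congr_ae (hmono ht hg),
        (dualConj C).intervalIntegral_comp_comm
          (intervalIntegrable_of_integrableOn_Ioo hfi ⟨le_rfl, hT.le⟩ (Ioo_subset_Icc_self ht)),
        ← map_add, ← h1, h2]
      ext w
      simp [hDC])
  refine ⟨c, ?_⟩
  filter_upwards [hc, hv, ae_restrict_mem measurableSet_Ioo] with t h1 h2 ht
  have h3 : D (u t) (Cr.compLp u t) = ((‖j (u t)‖ ^ 2 : ℝ) : 𝕜) := by rw [h2, ← hj]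
  rw [← h3, h1]
  congr 1
  refine intervalIntegral.integral_congr_ae ?_
  filter_upwards [hmono ht hv, hmono ht hg] with s h4 h5 hs
  rw [h4 hs, h5 hs]
  rfl

/-- Lions–Magenes: functions in `L²(0, T; V)` with derivative in `L²(0, T; V')` are a.e. equal to
continuous functions with values in the pivot space. -/
theorem exists_continuousOn_ae_eq [CompleteSpace H] (hD : ∀ x y, D x y = D y x)
    (hDC : ∀ x y, D (C x) y = conj (D x (C y)))
    (hj : ∀ x, D x (C x) = ((‖j x‖ ^ 2 : ℝ) : 𝕜)) {T : ℝ} (hT : 0 < T) (u : L2Time T V)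
    (f : L2Time T (V →L[𝕜] 𝕜)) {a : V →L[𝕜] 𝕜}
    (huf : ∀ᵐ t ∂volume.restrict (Ioo 0 T), D (u t) = a + ∫ s in (0 : ℝ)..t, f s) :
    ∃ U : ℝ → H, ContinuousOn U (Icc 0 T) ∧
      ∀ᵐ t ∂volume.restrict (Ioo 0 T), U t = j (u t) := by
  obtain ⟨c, hc⟩ := exists_norm_sq_eq_primitive D C j hD hDC hj hT u f huf
  set Q : ℝ → 𝕜 := fun s => f s (C (u s)) + conj (f s (C (u s))) with hQ
  set m : ℝ → ℝ := fun s => ‖f s‖ ^ 2 + ‖u s‖ ^ 2 with hm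
  have hf2 : IntegrableOn (fun s => ‖f s‖ ^ 2) (Ioo 0 T) :=
    (memLp_two_iff_integrable_sq_norm (Lp.memLp f).1).1 (Lp.memLp f)
  have hu2 : IntegrableOn (fun s => ‖u s‖ ^ 2) (Ioo 0 T) :=
    (memLp_two_iff_integrable_sq_norm (Lp.memLp u).1).1 (Lp.memLp u)
  have hmi : IntegrableOn m (Ioo 0 T) := hf2.add hu2
  have hfi : IntegrableOn f (Ioo 0 T) := (Lp.memLp f).integrable one_le_two
  have hQm : ∀ s, ‖Q s‖ ≤ m s := by
    intro s
    have h1 : ‖f s (C (u s))‖ ≤ ‖f s‖ * ‖u s‖ := by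
      simpa using (f s).le_opNorm (C (u s))
    calc ‖Q s‖ ≤ ‖f s (C (u s))‖ + ‖conj (f s (C (u s)))‖ := norm_add_le _ _
      _ ≤ m s := by
        rw [RCLike.norm_conj]
        simp only [hm]
        nlinarith [sq_nonneg (‖f s‖ - ‖u s‖)]
  have hQi : IntegrableOn Q (Ioo 0 T) := by
    have h1 : AEStronglyMeasurable (fun s => f s (C (u s))) (volume.restrict (Ioo 0 T)) := by
      have h2 : Continuous fun z : (V →L[𝕜] 𝕜) × V => z.1 (C z.2) :=
        continuous_fst.clm_apply (C.continuous.comp continuous_snd)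
      exact h2.comp_aestronglyMeasurable ((Lp.memLp f).1.prodMk (Lp.memLp u).1)
    exact hmi.mono' (h1.add (RCLike.continuous_conj.comp_aestronglyMeasurable h1))
      (Eventually.of_forall hQm)
  -- The good times, where both primitive formulas hold; they have full measure, and `j ∘ u` is to
  -- be extended from them.
  set A : Set ℝ := {t | t ∈ Ioo 0 T ∧ D (u t) = a + (∫ s in (0 : ℝ)..t, f s) ∧
    ((‖j (u t)‖ ^ 2 : ℝ) : 𝕜) = c + ∫ s in (0 : ℝ)..t, Q s} with hA
  have hAae : ∀ᵐ t ∂volume.restrict (Ioo 0 T), t ∈ A := by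
    filter_upwards [huf, hc, ae_restrict_mem measurableSet_Ioo] with t h1 h2 h3
    exact ⟨h3, h1, h2⟩
  have hAT : A ⊆ Icc 0 T := fun t ht => Ioo_subset_Icc_self ht.1
  have hmI : ∀ {x y}, x ∈ Icc 0 T → y ∈ Icc 0 T → IntervalIntegrable m volume x y :=
    fun hx hy => intervalIntegrable_of_integrableOn_Ioo hmi hx hy
  have h0 : (0 : ℝ) ∈ Icc 0 T := ⟨le_rfl, hT.le⟩
  -- Every subinterval contains a good time at which `‖u‖ ^ 2` does not exceed its mean.
  have hgood : ∀ x ∈ Icc 0 T, ∀ y ∈ Icc 0 T, x < y → ∃ s ∈ Ioo x y ∩ A,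
      (y - x) * ‖u s‖ ^ 2 ≤ ∫ t in x..y, ‖u t‖ ^ 2 := by
    intro x hx y hy hxy
    have hsub : Ioo x y ⊆ Ioo 0 T := Ioo_subset_Ioo hx.1 hy.2
    have hnull : (volume.restrict (Ioo x y)) (A ∩ Ioo x y)ᶜ = 0 := by
      have h1 : ∀ᵐ t ∂volume.restrict (Ioo x y), t ∈ A ∩ Ioo x y := by
        filter_upwards [ae_mono (Measure.restrict_mono_set volume hsub) hAae,
          ae_restrict_mem measurableSet_Ioo] with t h1 h2
        exact ⟨h1, h2⟩
      exact h1
    obtain ⟨s, hs, hle⟩ := exists_notMem_null_le_average (μ := volume.restrict (Ioo x y))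
      (by simp [hxy]) (hu2.mono_set hsub) hnull
    rw [notMem_compl_iff] at hs
    refine ⟨s, ⟨hs.2, hs.1⟩, ?_⟩
    rw [average_eq] at hle
    simp only [measureReal_restrict_apply MeasurableSet.univ, univ_inter, smul_eq_mul,
      Real.volume_real_Ioo_of_le hxy.le] at hle
    rw [intervalIntegral.integral_of_le hxy.le, integral_Ioc_eq_integral_Ioo]
    have hpos : 0 < y - x := sub_pos.2 hxy
    calc (y - x) * ‖u s‖ ^ 2 ≤ (y - x) * ((y - x)⁻¹ * ∫ t in Ioo x y, ‖u t‖ ^ 2) :=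
          mul_le_mul_of_nonneg_left hle hpos.le
      _ = _ := by rw [mul_inv_cancel_left₀ hpos.ne']
  -- In `norm_sub_sq_eq` the energy difference costs one integral of `m`; the two conjugate pairing
  -- terms cost another, by Young's inequality and the choice of `s`.
  have hest : ∀ x ∈ Icc 0 T, ∀ y ∈ Icc 0 T, x < y → ∀ s ∈ Icc x y ∩ A, ∀ t ∈ Icc x y ∩ A,
      (y - x) * ‖u s‖ ^ 2 ≤ ∫ t in x..y, ‖u t‖ ^ 2 →
      ‖j (u t) - j (u s)‖ ^ 2 ≤ 2 * ∫ τ in x..y, m τ := by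
    intro x hx y hy hxy s hs t ht hus
    have hsT := hAT hs.2
    have htT := hAT ht.2
    have hfI := intervalIntegrable_of_integrableOn_Ioo hfi (x := x) (y := y) hx hy
    have hmI' := hmI hx hy
    have hsubst : uIoc s t ⊆ uIoc x y := by
      rw [uIoc_of_le hxy.le]
      exact Ioc_subset_Ioc (le_min hs.1.1 ht.1.1) (max_le hs.1.2 ht.1.2)
    have e1 : ((‖j (u t)‖ ^ 2 : ℝ) : 𝕜) - ((‖j (u s)‖ ^ 2 : ℝ) : 𝕜) = ∫ τ in s..t, Q τ := by
      rw [ht.2.2.2, hs.2.2.2, add_sub_add_left_eq_sub,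
        intervalIntegral.integral_interval_sub_left
          (intervalIntegrable_of_integrableOn_Ioo hQi h0 htT)
          (intervalIntegrable_of_integrableOn_Ioo hQi h0 hsT)]
    have e2 : D (u t) - D (u s) = ∫ τ in s..t, f τ := by
      rw [ht.2.2.1, hs.2.2.1, add_sub_add_left_eq_sub,
        intervalIntegral.integral_interval_sub_left
          (intervalIntegrable_of_integrableOn_Ioo hfi h0 htT)
          (intervalIntegrable_of_integrableOn_Ioo hfi h0 hsT)]
    have b1 : ‖∫ τ in s..t, Q τ‖ ≤ ∫ τ in x..y, m τ := by
      rw [intervalIntegral.integral_of_le hxy.le, ← uIoc_of_le hxy.le]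
      refine (intervalIntegral.norm_integral_le_integral_norm_uIoc).trans ?_
      calc ∫ τ in uIoc s t, ‖Q τ‖ ≤ ∫ τ in uIoc s t, m τ :=
            integral_mono_of_nonneg (Eventually.of_forall fun _ => norm_nonneg _)
              ((intervalIntegrable_iff.1 hmI').mono_set hsubst) (Eventually.of_forall hQm)
        _ ≤ _ := setIntegral_mono_set (intervalIntegrable_iff.1 hmI')
              (Eventually.of_forall fun τ => by positivity) hsubst.eventuallyLE
    have b2 : ‖∫ τ in s..t, f τ‖ ≤ ∫ τ in x..y, ‖f τ‖ := by
      rw [intervalIntegral.integral_of_le hxy.le, ← uIoc_of_le hxy.le]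
      exact (intervalIntegral.norm_integral_le_integral_norm_uIoc).trans
        (setIntegral_mono_set (intervalIntegrable_iff.1 hfI.norm)
          (Eventually.of_forall fun τ => norm_nonneg _) hsubst.eventuallyLE)
    have b3 : 2 * ((∫ τ in x..y, ‖f τ‖) * ‖u s‖) ≤ ∫ τ in x..y, m τ := by
      have hf2I := intervalIntegrable_of_integrableOn_Ioo hf2 hx hy
      have hu2I := intervalIntegrable_of_integrableOn_Ioo hu2 hx hy
      calc 2 * ((∫ τ in x..y, ‖f τ‖) * ‖u s‖) = ∫ τ in x..y, 2 * (‖f τ‖ * ‖u s‖) := by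
            rw [intervalIntegral.integral_const_mul, intervalIntegral.integral_mul_const]
        _ ≤ ∫ τ in x..y, (‖f τ‖ ^ 2 + ‖u s‖ ^ 2) := by
            refine intervalIntegral.integral_mono_on hxy.le ((hfI.norm.mul_const _).const_mul _)
              (hf2I.add intervalIntegrable_const) fun τ _ => ?_
            nlinarith [sq_nonneg (‖f τ‖ - ‖u s‖)]
        _ = (∫ τ in x..y, ‖f τ‖ ^ 2) + (y - x) * ‖u s‖ ^ 2 := by
            rw [intervalIntegral.integral_add hf2I intervalIntegrable_const]
            simp
        _ ≤ _ := by
            rw [hm, intervalIntegral.integral_add hf2I hu2I]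
            linarith
    have b4 : ‖(D (u t) - D (u s)) (C (u s))‖ ≤ (∫ τ in x..y, ‖f τ‖) * ‖u s‖ := by
      rw [e2]
      refine (ContinuousLinearMap.le_opNorm _ _).trans ?_
      rw [C.norm_map]
      exact mul_le_mul_of_nonneg_right b2 (norm_nonneg _)
    have h1 := norm_sub_sq_eq D C j hD hDC hj (u t) (u s)
    rw [e1] at h1
    have h2 : ‖((‖j (u t) - j (u s)‖ ^ 2 : ℝ) : 𝕜)‖ = ‖j (u t) - j (u s)‖ ^ 2 := by
      rw [RCLike.norm_ofReal, abs_of_nonneg (by positivity)]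
    rw [← h2, h1]
    refine (norm_sub_le _ _).trans ?_
    rw [RCLike.norm_conj]
    have h3 := norm_sub_le (∫ τ in s..t, Q τ) ((D (u t) - D (u s)) (C (u s)))
    linarith
  have hlt : ∀ x ∈ A, ∀ y ∈ A, x < y → ‖j (u x) - j (u y)‖ ^ 2 ≤
      8 * |(∫ τ in (0 : ℝ)..x, m τ) - ∫ τ in (0 : ℝ)..y, m τ| := by
    intro x hx y hy hxy
    obtain ⟨s, hs, hus⟩ := hgood x (hAT hx) y (hAT hy) hxy
    have hs' : s ∈ Icc x y ∩ A := ⟨Ioo_subset_Icc_self hs.1, hs.2⟩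
    have h1 := hest x (hAT hx) y (hAT hy) hxy s hs' x ⟨⟨le_rfl, hxy.le⟩, hx⟩ hus
    have h2 := hest x (hAT hx) y (hAT hy) hxy s hs' y ⟨⟨hxy.le, le_rfl⟩, hy⟩ hus
    have h3 : ‖j (u x) - j (u y)‖ ≤ ‖j (u x) - j (u s)‖ + ‖j (u y) - j (u s)‖ := by
      have := norm_sub_le (j (u x) - j (u s)) (j (u y) - j (u s))
      rwa [sub_sub_sub_cancel_right] at this
    have h4 : (∫ τ in x..y, m τ) ≤ |(∫ τ in (0 : ℝ)..x, m τ) - ∫ τ in (0 : ℝ)..y, m τ| := by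
      rw [abs_sub_comm, intervalIntegral.integral_interval_sub_left (hmI h0 (hAT hy))
        (hmI h0 (hAT hx))]
      exact le_abs_self _
    -- The constant is `8 = 2 * (2 + 2)`, from `(α + β)² ≤ 2 (α² + β²)` and `hest` at both
    -- endpoints.
    nlinarith [norm_nonneg (j (u x) - j (u y)), norm_nonneg (j (u x) - j (u s)),
      norm_nonneg (j (u y) - j (u s)), sq_nonneg (‖j (u x) - j (u s)‖ - ‖j (u y) - j (u s)‖)]
  have hosc : ∀ x ∈ A, ∀ y ∈ A, ‖j (u x) - j (u y)‖ ^ 2 ≤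
      8 * |(∫ τ in (0 : ℝ)..x, m τ) - ∫ τ in (0 : ℝ)..y, m τ| := by
    intro x hx y hy
    rcases lt_trichotomy x y with h | h | h
    · exact hlt x hx y hy h
    · simp [h]
    · rw [norm_sub_rev, abs_sub_comm]
      exact hlt y hy x hx h
  have hclosure : Icc 0 T ⊆ closure A := by
    rw [← closure_Ioo hT.ne]
    refine closure_minimal (fun t ht => ?_) isClosed_closure
    rw [Metric.mem_closure_iff]
    intro ε hε
    obtain ⟨s, hs, -⟩ := hgood t (Ioo_subset_Icc_self ht) (min (t + ε) T)
      ⟨le_min (by linarith [ht.1]) hT.le, min_le_right _ _⟩ (lt_min (by linarith) ht.2)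
    refine ⟨s, hs.2, ?_⟩
    rw [dist_comm, Real.dist_eq, abs_of_nonneg (by linarith [hs.1.1])]
    linarith [hs.1.2, min_le_left (t + ε) T]
  obtain ⟨h1, h2⟩ := continuousOn_extendFrom_of_dist_sq_le (φ := fun t => j (u t)) hAT hclosure
    (continuousOn_primitive_Icc hT hmi) hosc
  exact ⟨_, h1, hAae.mono fun t ht => h2 t ht⟩

end Continuity

/-! ### Complex conjugation on the Sobolev space -/

section Conjugation

variable {𝕜 : Type*} [RCLike 𝕜]

/-- The pointwise action of a conjugation on `L²`. -/
noncomputable def conjLp {α E : Type*} [MeasurableSpace α] (μ : Measure α) [NormedAddCommGroup E]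
    [NormedSpace 𝕜 E] (c : E →ₗᵢ⋆[𝕜] E) : Lp E 2 μ →ₗᵢ⋆[𝕜] Lp E 2 μ where
  toLinearMap := (c.toContinuousLinearMap.compLpL 2 μ : Lp E 2 μ →ₛₗ[starRingEnd 𝕜] Lp E 2 μ)
  norm_map' f := by
    have h := c.toContinuousLinearMap.coeFn_compLp f
    refine le_antisymm (Lp.norm_le_norm_of_ae_le ?_) (Lp.norm_le_norm_of_ae_le ?_)
    · filter_upwards [h] with x hx
      exact ((congrArg norm hx).trans (c.norm_map _)).le
    · filter_upwards [h] with x hx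
      exact ((congrArg norm hx).trans (c.norm_map _)).ge

theorem coeFn_conjLp {α E : Type*} [MeasurableSpace α] {μ : Measure α} [NormedAddCommGroup E]
    [NormedSpace 𝕜 E] (c : E →ₗᵢ⋆[𝕜] E) (f : Lp E 2 μ) :
    conjLp μ c f =ᵐ[μ] fun x => c (f x) :=
  c.toContinuousLinearMap.coeFn_compLp f

/-- Coordinatewise conjugation on `𝕜ⁿ`. -/
noncomputable def conjEuclidean (n : ℕ) :
    EuclideanSpace 𝕜 (Fin n) →ₗᵢ⋆[𝕜] EuclideanSpace 𝕜 (Fin n) where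
  toFun x := WithLp.toLp 2 fun i => conj (x i)
  map_add' x y := by ext; simp
  map_smul' c x := by ext; simp
  norm_map' x := by simp [EuclideanSpace.norm_eq]

theorem conjEuclidean_apply {n : ℕ} (x : EuclideanSpace 𝕜 (Fin n)) (i : Fin n) :
    conjEuclidean n x i = conj (x i) := rfl

/-- The product of two conjugations on a Hilbert sum. -/
noncomputable def conjProd {E F : Type*} [NormedAddCommGroup E] [NormedSpace 𝕜 E]
    [NormedAddCommGroup F] [NormedSpace 𝕜 F] (c : E →ₗᵢ⋆[𝕜] E) (d : F →ₗᵢ⋆[𝕜] F) :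
    WithLp 2 (E × F) →ₗᵢ⋆[𝕜] WithLp 2 (E × F) where
  toFun p := WithLp.toLp 2 (c p.fst, d p.snd)
  map_add' p q := by simp [← WithLp.toLp_add]
  map_smul' a p := by simp [← WithLp.toLp_smul, c.map_smulₛₗ, d.map_smulₛₗ]
  norm_map' p := by
    change ‖WithLp.toLp 2 (c p.fst, d p.snd)‖ = ‖p‖
    rw [WithLp.prod_norm_eq_of_L2, WithLp.prod_norm_eq_of_L2]
    simp

/-- The restriction of a conjugation to an invariant subspace. -/
def conjRestrict {E : Type*} [NormedAddCommGroup E] [NormedSpace 𝕜 E] (c : E →ₗᵢ⋆[𝕜] E)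
    (S : Submodule 𝕜 E) (h : ∀ x ∈ S, c x ∈ S) : S →ₗᵢ⋆[𝕜] S where
  toFun x := ⟨c x, h x x.2⟩
  map_add' x y := Subtype.ext (map_add c x.1 y.1)
  map_smul' a x := Subtype.ext (c.map_smulₛₗ a x.1)
  norm_map' x := c.norm_map x.1

variable (𝕜) in
/-- Conjugation on the scalars. -/
noncomputable def conjScalar : 𝕜 →ₗᵢ⋆[𝕜] 𝕜 := (starₗᵢ 𝕜 : 𝕜 ≃ₗᵢ⋆[𝕜] 𝕜).toLinearIsometry

theorem conjScalar_apply (x : 𝕜) : conjScalar 𝕜 x = conj x := rfl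

variable {n : ℕ} {Ω : Set (EuclideanSpace ℝ (Fin n))}

/-- Test functions are real-valued, so conjugation passes through the defining identity. -/
theorem IsWeakGradient.conj {u : L2 𝕜 Ω} {g : L2Vec 𝕜 Ω} (h : IsWeakGradient u g) :
    IsWeakGradient (conjLp _ (conjScalar 𝕜) u) (conjLp _ (conjEuclidean n) g) := by
  intro φ hφ i
  have e1 : ∫ x in Ω, fderiv ℝ φ x (EuclideanSpace.single i 1) •
      (conjLp _ (conjScalar 𝕜) u : L2 𝕜 Ω) x
      = starRingEnd 𝕜 (∫ x in Ω, fderiv ℝ φ x (EuclideanSpace.single i 1) • u x) := by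
    rw [← integral_conj]
    refine integral_congr_ae ?_
    filter_upwards [coeFn_conjLp (conjScalar 𝕜) u] with x hx
    rw [hx, conjScalar_apply]
    simp [RCLike.real_smul_eq_coe_mul]
  have e2 : ∫ x in Ω, φ x • (conjLp _ (conjEuclidean n) g : L2Vec 𝕜 Ω) x i
      = starRingEnd 𝕜 (∫ x in Ω, φ x • g x i) := by
    rw [← integral_conj]
    refine integral_congr_ae ?_
    filter_upwards [coeFn_conjLp (conjEuclidean n) g] with x hx
    rw [hx, conjEuclidean_apply]
    simp [RCLike.real_smul_eq_coe_mul]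
  rw [e1, e2, h φ hφ i, map_neg]

theorem H1.mem_iff {p : WithLp 2 (L2 𝕜 Ω × L2Vec 𝕜 Ω)} :
    p ∈ H1 𝕜 Ω ↔ IsWeakGradient p.fst p.snd := Iff.rfl

variable (𝕜 Ω) in
/-- Complex conjugation on `L²(Ω) × L²(Ω)ⁿ`. -/
noncomputable def conjPair :
    WithLp 2 (L2 𝕜 Ω × L2Vec 𝕜 Ω) →ₗᵢ⋆[𝕜] WithLp 2 (L2 𝕜 Ω × L2Vec 𝕜 Ω) :=
  conjProd (conjLp (volume.restrict Ω) (conjScalar 𝕜)) (conjLp (volume.restrict Ω) (conjEuclidean n))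

theorem conjPair_mem_H1 (p : WithLp 2 (L2 𝕜 Ω × L2Vec 𝕜 Ω)) (hp : p ∈ H1 𝕜 Ω) :
    conjPair 𝕜 Ω p ∈ H1 𝕜 Ω :=
  H1.mem_iff.2 (IsWeakGradient.conj (u := p.fst) (g := p.snd) (H1.mem_iff.1 hp))

variable (𝕜 Ω) in
/-- Complex conjugation on `H¹(Ω)`. -/
noncomputable def H1.conj : H1 𝕜 Ω →ₗᵢ⋆[𝕜] H1 𝕜 Ω :=
  conjRestrict (conjPair 𝕜 Ω) (H1 𝕜 Ω) conjPair_mem_H1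

theorem H1.coeFn_toL2_conj (u : H1 𝕜 Ω) :
    H1.toL2 𝕜 Ω (H1.conj 𝕜 Ω u) =ᵐ[volume.restrict Ω] fun x => starRingEnd 𝕜 (H1.toL2 𝕜 Ω u x) :=
  coeFn_conjLp (conjScalar 𝕜) u.1.fst

theorem H1.toDual_symm (u w : H1 𝕜 Ω) : H1.toDual 𝕜 Ω u w = H1.toDual 𝕜 Ω w u := by
  rw [H1.toDual_apply, H1.toDual_apply]
  exact integral_congr_ae (Eventually.of_forall fun x => mul_comm _ _)

theorem H1.toDual_conj (u w : H1 𝕜 Ω) :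
    H1.toDual 𝕜 Ω (H1.conj 𝕜 Ω u) w = starRingEnd 𝕜 (H1.toDual 𝕜 Ω u (H1.conj 𝕜 Ω w)) := by
  rw [H1.toDual_apply, H1.toDual_apply, ← integral_conj]
  refine integral_congr_ae ?_
  filter_upwards [H1.coeFn_toL2_conj u, H1.coeFn_toL2_conj w] with x h1 h2
  rw [h1, h2]
  simp

theorem H1.toDual_self_conj (u : H1 𝕜 Ω) :
    H1.toDual 𝕜 Ω u (H1.conj 𝕜 Ω u) = ((‖H1.toL2 𝕜 Ω u‖ ^ 2 : ℝ) : 𝕜) := by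
  have h := inner_self_eq_norm_sq_to_K (𝕜 := 𝕜) (H1.toL2 𝕜 Ω u)
  rw [L2.inner_def] at h
  rw [RCLike.ofReal_pow, ← h, H1.toDual_apply]
  refine integral_congr_ae ?_
  filter_upwards [H1.coeFn_toL2_conj u] with x h1
  rw [h1, RCLike.inner_apply]

end Conjugation

/-! ### The Dirichlet and boundary forms as bounded operators -/

section Forms

variable {𝕜 : Type*} [RCLike 𝕜] {n : ℕ} {Ω : Set (EuclideanSpace ℝ (Fin n))}

variable (𝕜 Ω) in
/-- The Dirichlet form as a bounded operator `H¹(Ω) → (H¹(Ω))'`. -/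
noncomputable def dirichletOperator : H1 𝕜 Ω →L[𝕜] H1Dual 𝕜 Ω :=
  ((∑ i : Fin n, (ContinuousLinearMap.mul 𝕜 𝕜).bilinearComp (EuclideanSpace.proj i)
    (EuclideanSpace.proj i)).lpPairing (volume.restrict Ω) 2 2).bilinearComp
    ((WithLp.sndL 2 𝕜 (L2 𝕜 Ω) (L2Vec 𝕜 Ω)).comp (H1 𝕜 Ω).subtypeL)
    ((WithLp.sndL 2 𝕜 (L2 𝕜 Ω) (L2Vec 𝕜 Ω)).comp (H1 𝕜 Ω).subtypeL)

theorem dirichletOperator_apply (u w : H1 𝕜 Ω) :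
    dirichletOperator 𝕜 Ω u w = dirichletForm u w := by
  simp [dirichletOperator, dirichletForm, ContinuousLinearMap.lpPairing_eq_integral, H1.grad]

/-- The boundary form as a bounded operator `H¹(Ω) → (H¹(Ω))'`. -/
noncomputable def boundaryOperator (ρ : LInftyBoundary 𝕜 Ω) : H1 𝕜 Ω →L[𝕜] H1Dual 𝕜 Ω :=
  ((ContinuousLinearMap.mul 𝕜 𝕜).lpPairing (surfaceMeasure Ω) 2 2).bilinearComp
    (trace 𝕜 Ω) (((ContinuousLinearMap.mul 𝕜 𝕜).holderL (surfaceMeasure Ω) ∞ 2 2 ρ).comp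
      (trace 𝕜 Ω))

theorem boundaryOperator_apply (ρ : LInftyBoundary 𝕜 Ω) (u w : H1 𝕜 Ω) :
    boundaryOperator ρ u w = boundaryForm ρ u w := by
  simp only [boundaryOperator, boundaryForm, ContinuousLinearMap.bilinearComp_apply,
    ContinuousLinearMap.lpPairing_eq_integral, ContinuousLinearMap.comp_apply]
  refine integral_congr_ae ?_
  filter_upwards [(ContinuousLinearMap.mul 𝕜 𝕜).coeFn_holder (r := 2) ρ (trace 𝕜 Ω w)] with x hx
  rw [ContinuousLinearMap.holderL_apply_apply, hx]
  simp only [ContinuousLinearMap.mul_apply']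
  ring

theorem dirichletForm_symm (u w : H1 𝕜 Ω) : dirichletForm u w = dirichletForm w u := by
  simp only [dirichletForm, mul_comm]

theorem boundaryForm_symm (ρ : LInftyBoundary 𝕜 Ω) (u w : H1 𝕜 Ω) :
    boundaryForm ρ u w = boundaryForm ρ w u := by
  simp only [boundaryForm, mul_comm (trace 𝕜 Ω u _)]

end Forms

/-! ### Weak equations for almost every time, and integration by parts -/

section WeakSolutions

variable {𝕜 : Type*} [RCLike 𝕜]

/-- Functionals that depend integrably on time are determined a.e. by testing. -/
theorem ae_eq_of_forall_integral_smul_eq {X : Type*} [NormedAddCommGroup X] [NormedSpace 𝕜 X]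
    {T : ℝ} {F G : ℝ → X →L[𝕜] 𝕜} (hF : IntegrableOn F (Ioo 0 T)) (hG : IntegrableOn G (Ioo 0 T))
    (h : ∀ w : X, ∀ φ : ℝ → ℝ, IsTestFunction (Ioo 0 T) φ →
      ∫ t in Ioo 0 T, φ t • F t w = ∫ t in Ioo 0 T, φ t • G t w) :
    ∀ᵐ t ∂volume.restrict (Ioo 0 T), F t = G t := by
  have key : ∀ᵐ t ∂volume, t ∈ Ioo 0 T → F t - G t = 0 := by
    refine isOpen_Ioo.ae_eq_zero_of_integral_contDiff_smul_eq_zero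
      (hF.sub hG).locallyIntegrableOn ?_
    intro φ h1 h2 h3
    have hmul : ∀ {K : ℝ → X →L[𝕜] 𝕜}, IntegrableOn K (Ioo 0 T) →
        IntegrableOn (fun t => φ t • K t) (Ioo 0 T) := by
      intro K hK
      obtain ⟨C, hC⟩ := h1.continuous.bounded_above_of_compact_support h2
      exact hK.bdd_smul C h1.continuous.aestronglyMeasurable (Eventually.of_forall hC)
    have h6 : ∫ t, φ t • (F t - G t) = ∫ t in Ioo 0 T, φ t • (F t - G t) :=
      (setIntegral_eq_integral_of_forall_compl_eq_zero fun t ht => by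
        rw [image_eq_zero_of_notMem_tsupport fun h => ht (h3 h), zero_smul ℝ (F t - G t)]).symm
    rw [h6]
    simp only [smul_sub]
    rw [integral_sub (hmul hF) (hmul hG), sub_eq_zero]
    ext w
    rw [ContinuousLinearMap.integral_apply (hmul hF), ContinuousLinearMap.integral_apply (hmul hG)]
    exact h w φ ⟨h1, h2, h3⟩
  rw [ae_restrict_iff' measurableSet_Ioo]
  filter_upwards [key] with t ht htm
  exact sub_eq_zero.1 (ht htm)

variable {n : ℕ} {Ω : Set (EuclideanSpace ℝ (Fin n))} {T : ℝ}

theorem integrableOn_L2Time {X : Type*} [NormedAddCommGroup X] (f : L2Time T X) :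
    IntegrableOn f (Ioo 0 T) :=
  (Lp.memLp f).integrable one_le_two

theorem integrableOn_apply_L2Time {X : Type*} [NormedAddCommGroup X] [NormedSpace 𝕜 X]
    (f : L2Time T (X →L[𝕜] 𝕜)) (u : L2Time T X) :
    IntegrableOn (fun t => f t (u t)) (Ioo 0 T) :=
  memLp_one_iff_integrable.1
    ((ContinuousLinearMap.id 𝕜 (X →L[𝕜] 𝕜)).memLp_of_bilin 1 (Lp.memLp f) (Lp.memLp u))

/-- The null set is the same for all `w`, because the two sides are compared as functions with
values in the dual. This permits test elements that vary with `t`. -/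
theorem ae_eq_of_weak_equation {X Y : Type*} [NormedAddCommGroup X] [NormedSpace 𝕜 X]
    [NormedAddCommGroup Y] [NormedSpace 𝕜 Y] (g : L2Time T (X →L[𝕜] 𝕜)) (u : L2Time T X)
    (f : L2Time T (X →L[𝕜] 𝕜)) (h : L2Time T Y) (A : X →L[𝕜] X →L[𝕜] 𝕜) (R : Y →L[𝕜] X →L[𝕜] 𝕜)
    (heq : ∀ w : X, ∀ φ : ℝ → ℝ, IsTestFunction (Ioo 0 T) φ →
      ∫ t in Ioo 0 T, φ t • (g t w + A (u t) w) = ∫ t in Ioo 0 T, φ t • (f t w + R (h t) w)) :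
    ∀ᵐ t ∂volume.restrict (Ioo 0 T), ∀ w, g t w + A (u t) w = f t w + R (h t) w := by
  have := ae_eq_of_forall_integral_smul_eq
    ((integrableOn_L2Time g).add (A.integrable_comp (integrableOn_L2Time u)))
    ((integrableOn_L2Time f).add (R.integrable_comp (integrableOn_L2Time h))) heq
  exact this.mono fun t ht w => DFunLike.congr_fun ht w

variable (𝕜 Ω) in
/-- The embedding `H^{-1/2}(∂Ω) → (H¹(Ω))'` dual to the trace. -/
noncomputable def pullTrace : HMinusHalf 𝕜 Ω →L[𝕜] H1Dual 𝕜 Ω :=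
  (traceHalf 𝕜 Ω).precomp 𝕜

theorem W.exists_toDual_eq_primitive (hT : 0 < T) (u : W 𝕜 Ω T) :
    ∃ a, ∀ᵐ t ∂volume.restrict (Ioo 0 T),
      H1.toDual 𝕜 Ω (u.val t) = a + ∫ s in (0 : ℝ)..t, u.deriv s :=
  exists_eq_primitive_of_weakDeriv (H1.toDual 𝕜 Ω) hT u.val u.deriv u.isDeriv

theorem W.exists_isContinuousRepresentative (hT : 0 < T) (u : W 𝕜 Ω T) :
    ∃ U, IsContinuousRepresentative u U := by
  obtain ⟨a, ha⟩ := u.exists_toDual_eq_primitive hT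
  exact exists_continuousOn_ae_eq (H1.toDual 𝕜 Ω) (H1.conj 𝕜 Ω) (H1.toL2 𝕜 Ω) H1.toDual_symm
    H1.toDual_conj H1.toDual_self_conj hT u.val u.deriv ha

/-- Integration by parts in time. -/
theorem W.integral_deriv_add_integral_deriv (hT : 0 < T) (u v : W 𝕜 Ω T) {U V : ℝ → L2 𝕜 Ω}
    (hU : IsContinuousRepresentative u U) (hV : IsContinuousRepresentative v V) :
    (∫ x in Ω, U T x * V T x) - (∫ x in Ω, U 0 x * V 0 x) =
      ∫ t in Ioo 0 T, (u.deriv t (v.val t) + v.deriv t (u.val t)) := by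
  obtain ⟨a, ha⟩ := u.exists_toDual_eq_primitive hT
  obtain ⟨b, hb⟩ := v.exists_toDual_eq_primitive hT
  obtain ⟨c, hc⟩ := product_rule_dual (H1.toDual 𝕜 Ω) H1.toDual_symm hT u.val v.val
    u.deriv v.deriv ha hb
  have hP : ∀ f g : L2 𝕜 Ω, (ContinuousLinearMap.mul 𝕜 𝕜).lpPairing (volume.restrict Ω) 2 2 f g =
      ∫ x in Ω, f x * g x := fun f g => by simp [ContinuousLinearMap.lpPairing_eq_integral]
  have hcont : ContinuousOn (fun t => ∫ x in Ω, U t x * V t x) (Icc 0 T) := by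
    simp only [← hP]
    exact (((ContinuousLinearMap.mul 𝕜 𝕜).lpPairing (volume.restrict Ω) 2 2).continuous
      |>.comp_continuousOn
      hU.1).clm_apply hV.1
  refine sub_eq_integral_of_ae_eq_primitive hT (c := c) hcont
    ((integrableOn_apply_L2Time u.deriv v.val).add (integrableOn_apply_L2Time v.deriv u.val)) ?_
  filter_upwards [hc, hU.2, hV.2] with t h1 h2 h3
  rw [h2, h3, ← H1.toDual_apply]
  exact h1

theorem IsForwardWeakSolution.ae_eq {ρ : LInftyBoundary 𝕜 Ω} {f : L2Time T (H1Dual 𝕜 Ω)}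
    {h : L2Time T (HMinusHalf 𝕜 Ω)} {u : W 𝕜 Ω T} (hu : IsForwardWeakSolution ρ f h u) :
    ∀ᵐ t ∂volume.restrict (Ioo 0 T), ∀ w,
      u.deriv t w + dirichletForm (u.val t) w + boundaryForm ρ (u.val t) w =
        f t w + h t (traceHalf 𝕜 Ω w) := by
  have h1 := ae_eq_of_weak_equation (𝕜 := 𝕜) (X := H1 𝕜 Ω) (Y := HMinusHalf 𝕜 Ω) (T := T)
    u.deriv u.val f h
  have h2 := h1 (dirichletOperator 𝕜 Ω + boundaryOperator ρ) (pullTrace 𝕜 Ω)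
  have hA : ∀ x w, (dirichletOperator 𝕜 Ω + boundaryOperator ρ) x w =
      dirichletForm x w + boundaryForm ρ x w := fun x w => by
    rw [← dirichletOperator_apply, ← boundaryOperator_apply]; rfl
  have hR : ∀ k w, pullTrace 𝕜 Ω k w = k (traceHalf 𝕜 Ω w) := fun k w => rfl
  simp only [hA, hR, ← add_assoc] at h2
  exact h2 hu

theorem IsBackwardWeakSolution.ae_eq {ρ : LInftyBoundary 𝕜 Ω} {f : L2Time T (H1Dual 𝕜 Ω)}
    {h : L2Time T (HMinusHalf 𝕜 Ω)} {v : W 𝕜 Ω T} (hv : IsBackwardWeakSolution ρ f h v) :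
    ∀ᵐ t ∂volume.restrict (Ioo 0 T), ∀ w,
      v.deriv t w - dirichletForm (v.val t) w - boundaryForm ρ (v.val t) w =
        f t w - h t (traceHalf 𝕜 Ω w) := by
  have h1 := ae_eq_of_weak_equation (𝕜 := 𝕜) (X := H1 𝕜 Ω) (Y := HMinusHalf 𝕜 Ω) (T := T)
    v.deriv v.val f h
  -- Reversing time orientation flips the sign of both the elliptic part and the boundary data.
  have h2 := h1 (-(dirichletOperator 𝕜 Ω + boundaryOperator ρ)) (-pullTrace 𝕜 Ω)
  have hA : ∀ x w, (-(dirichletOperator 𝕜 Ω + boundaryOperator ρ)) x w =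
      -(dirichletForm x w + boundaryForm ρ x w) := fun x w => by
    rw [← dirichletOperator_apply, ← boundaryOperator_apply]; rfl
  have hR : ∀ k w, (-pullTrace 𝕜 Ω) k w = -(k (traceHalf 𝕜 Ω w)) := fun k w => rfl
  simp only [hA, hR, ← sub_eq_add_neg, ← sub_sub] at h2
  exact h2 hv

/-- Integrability of `r - s` need not be checked separately: it is a.e. a difference of the two
integrable sums. -/
theorem integral_sub_eq_of_ae_eq {p q r s k l : ℝ → 𝕜} {a b : 𝕜} {μ : Measure ℝ}
    (hkl : Integrable (fun t => k t + l t) μ) (hpq : Integrable (fun t => p t + q t) μ)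
    (hab : b - a = ∫ t, (p t + q t) ∂μ) (h : ∀ᵐ t ∂μ, p t + q t = k t + l t - (r t - s t)) :
    ∫ t, (r t - s t) ∂μ = a - b + ∫ t, (k t + l t) ∂μ := by
  rw [← neg_sub b a, hab, neg_add_eq_sub, ← integral_sub hkl hpq]
  refine integral_congr_ae ?_
  filter_upwards [h] with t ht
  linear_combination ht

end WeakSolutions

end RobinHeat

/-! ### The integral identity -/

open RobinHeat in
theorem proposition2p1 {𝕜 : Type*} [RCLike 𝕜] {n : ℕ} (hn : 1 ≤ n) (hn3 : n ≤ 3)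
    {Ω : Set (EuclideanSpace ℝ (Fin n))} (hΩ : IsBoundedSmoothDomain Ω)
    {T : ℝ} (hT : 0 < T) (ρ : LInftyBoundary 𝕜 Ω)
    (f₀ f₁ : L2Time T (H1Dual 𝕜 Ω)) (h₀ h₁ : L2Time T (HMinusHalf 𝕜 Ω))
    (u v : W 𝕜 Ω T)
    (hu : IsForwardWeakSolution ρ f₀ h₀ u) (hv : IsBackwardWeakSolution ρ f₁ h₁ v) :
    (∃ U, IsContinuousRepresentative u U) ∧ (∃ V, IsContinuousRepresentative v V) ∧
    ∀ U V : ℝ → L2 𝕜 Ω,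
      IsContinuousRepresentative u U → IsContinuousRepresentative v V →
      ∫ t in Ioo 0 T,
          (h₁ t (traceHalf 𝕜 Ω (u.val t)) - h₀ t (traceHalf 𝕜 Ω (v.val t))) =
        (∫ x in Ω, U 0 x * V 0 x) - (∫ x in Ω, U T x * V T x)
          + ∫ t in Ioo 0 T, (f₁ t (u.val t) + f₀ t (v.val t)) := by
  refine ⟨u.exists_isContinuousRepresentative hT, v.exists_isContinuousRepresentative hT,
    fun U V hU hV => ?_⟩
  refine integral_sub_eq_of_ae_eq (μ := volume.restrict (Ioo 0 T))
    ((integrableOn_apply_L2Time f₁ u.val).add (integrableOn_apply_L2Time f₀ v.val))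
    ((integrableOn_apply_L2Time u.deriv v.val).add (integrableOn_apply_L2Time v.deriv u.val))
    (W.integral_deriv_add_integral_deriv hT u v hU hV) ?_
  filter_upwards [hu.ae_eq, hv.ae_eq] with t h1 h2
  -- Each solution is tested with the other; after symmetrisation the forms cancel in the sum.
  have e1 := h1 (v.val t)
  have e2 := h2 (u.val t)
  rw [dirichletForm_symm, boundaryForm_symm] at e2
  linear_combination e1 + e2
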